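/- **Setting.** For $\ell\in\mathbb Z^k$ and $f\in L^2(\mathbb R^k)$ let $T_\ell f(x)=f(x-\ell)$, and for a finite sequence $\mathcal F=\{f_i\}_{i=1}^n$ in $L^2(\mathbb R^k)$ let $E(\mathcal F)=\{T_\ell f_i\}_{(\ell,i)\in\mathbb Z^k\times\{1,\dots,n\}}$. A closed subspace of $L^2(\mathbb R^k)$ is finitely generated shift-invariant (FSI) if it is the closed linear span of the integer translates of a finite set. For a Bessel family $\mathcal G=\{g_j\}_j$ let $T_{\mathcal G}$ be its synthesis operator $a\mapsto\sum_j a_jg_j$ on $\ell^2$, and $S_{\mathcal G}=T_{\mathcal G}T_{\mathcal G}^*$ its frame operator. Let $\mathbb T=[-1/2,1/2)$ and, for $f\in L^2(\mathbb R^k)$ and a.e. $x\in\mathbb T^k$, let $\Gamma f(x)=(\hat f(x+\ell))_{\ell\in\mathbb Z^k}\in\ell^2(\mathbb Z^k)$. The range function $J_{\mathcal V}$ of a shift-invariant subspace $\mathcal V$ is the (a.e. unique) weakly measurable field of closed subspaces of $\ell^2(\mathbb Z^k)$ with $\mathcal V=\{f:\Gamma f(x)\in J_{\mathcal V}(x)\text{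 for a.e. }x\in\mathbb T^k\}$. A bounded operator $S$ on $L^2(\mathbb R^k)$ is shift preserving if $T_\ell S=ST_\ell$ for all $\ell\in\mathbb Z^k$; then $[S]$ denotes the (a.e. unique) weakly measurable, essentially bounded field of operators on $\ell^2(\mathbb Z^k)$ with $[S]_x(\Gamma f(x))=\Gamma(Sf)(x)$ for a.e. $x\in\mathbb T^k$, for every $f\in L^2(\mathbb R^k)$. Let $\mathcal V,\mathcal W\subseteq L^2(\mathbb R^k)$ be FSI subspaces with $\mathcal V\oplus\mathcal W^\perp=L^2(\mathbb R^k)$ (algebraic direct sum), and let $\mathcal F=\{f_i\}_{i=1}^n$ be a finite sequence in $\mathcal W$ such that $E(\mathcal F)$ is a frame for $\mathcal W$. Let $P_{\mathcal V//\mathcal W^\perp}$ be the projection onto $\mathcal V$ along $\mathcal W^\perp$, and let the canonical $\mathcal V$-dual $E(\mathcal F)^\#_{\mathcal V}$ of $E(\mathcal F)$ be the family $\{P_{\mathcal V//\mathcal W^\perp}S_{E(\mathcal F)}^\dagger T_\ell f_i\}_{(\ell,i)}$, where $\dagger$ is the Moore–Penrose pseudo-inverse. Let $\mathcal D^{SG}_{\mathcal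 V}(\mathcal F)$ be the set of all Bessel families $E(\mathcal G)$ with $\mathcal G=\{g_i\}_{i=1}^n$ in $\mathcal V$ such that $f=\sum_{(\ell,i)}\langle f,T_\ell g_i\rangle T_\ell f_i$ for every $f\in\mathcal W$ (the shift-generated oblique $\mathcal V$-duals of $E(\mathcal F)$). Let $d(x)=\dim J_{\mathcal V}(x)$, and let $U_{\mathcal V}(E(\mathcal F)^\#_{\mathcal V})$ be the set of all operators $S_{E(\mathcal F)^\#_{\mathcal V}}+B$, where $B$ is a positive semidefinite bounded operator on $L^2(\mathbb R^k)$ that is shift preserving, has range $R(B)\subset\mathcal V$, and satisfies $\operatorname{rank}([B]_x)\le n-d(x)$ for a.e. $x\in\mathbb T^k$. **Proposition.** The canonical $\mathcal V$-dual is shift generated, $E(\mathcal F)^\#_{\mathcal V}=\{T_\ell f^\#_{\mathcal V,i}\}_{(\ell,i)}$ with $f^\#_{\mathcal V,i}=P_{\mathcal V//\mathcal W^\perp}S_{E(\mathcal F)}^\dagger f_i$, and $$\{S_{E(\mathcal G)}: E(\mathcal G)\in\mathcal D^{SG}_{\mathcal V}(\mathcal F)\}=U_{\mathcal V}(E(\mathcal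 F)^\#_{\mathcal V}).$$ -/

import Mathlib

open MeasureTheory FourierTransform
open scoped InnerProductSpace ENNReal

noncomputable section

/-! ### Frames, frame operators and oblique duals in a Hilbert space -/

section Frames

variable {ι H : Type} [NormedAddCommGroup H] [InnerProductSpace ℂ H]

/-- The Hilbert space `ℓ²(ι)`. -/
abbrev Ell2 (ι : Type) : Type := lp (fun _ : ι => ℂ) 2

/-- `∑ |⟨h, f i⟩|² ≤ b ‖h‖²` for all `h`, with convergence of the series. -/
def IsBessel (f : ι → H) : Prop :=
  ∃ b : ℝ, 0 < b ∧ ∀ h : H,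
    Summable (fun i => ‖⟪f i, h⟫_ℂ‖ ^ 2) ∧ ∑' i, ‖⟪f i, h⟫_ℂ‖ ^ 2 ≤ b * ‖h‖ ^ 2

/-- `f` is a sequence in `W` and is a frame for `W`. -/
def IsFrameFor (W : Submodule ℂ H) (f : ι → H) : Prop :=
  (∀ i, f i ∈ W) ∧ ∃ a b : ℝ, 0 < a ∧ a ≤ b ∧ ∀ h ∈ W,
    Summable (fun i => ‖⟪f i, h⟫_ℂ‖ ^ 2) ∧
      a * ‖h‖ ^ 2 ≤ ∑' i, ‖⟪f i, h⟫_ℂ‖ ^ 2 ∧ ∑' i, ‖⟪f i, h⟫_ℂ‖ ^ 2 ≤ b * ‖h‖ ^ 2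

theorem IsBessel.memℓp {f : ι → H} (hf : IsBessel f) (h : H) :
    Memℓp (fun i => ⟪f i, h⟫_ℂ) 2 := by
  obtain ⟨b, -, hb⟩ := hf
  rw [memℓp_gen_iff (by norm_num)]
  simpa using (hb h).1

/-- The analysis operator `h ↦ (⟨h, f i⟩)ᵢ` of a Bessel sequence, as a linear map. -/
def analysisLin (f : ι → H) (hf : IsBessel f) : H →ₗ[ℂ] Ell2 ι where
  toFun h := ⟨fun i => ⟪f i, h⟫_ℂ, hf.memℓp h⟩
  map_add' x y := by ext i; exact inner_add_right _ _ _
  map_smul' c x := by ext i; exact inner_smul_right _ _ _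

theorem analysisLin_bound (f : ι → H) (hf : IsBessel f) :
    ∃ C : ℝ, ∀ h, ‖analysisLin f hf h‖ ≤ C * ‖h‖ := by
  obtain ⟨b, hb0, hb⟩ := id hf
  refine ⟨Real.sqrt b, fun h => ?_⟩
  have h1 : ‖analysisLin f hf h‖ ^ 2 ≤ b * ‖h‖ ^ 2 := by
    have h2 := lp.norm_rpow_eq_tsum (p := 2) (by norm_num) (analysisLin f hf h)
    have h3 := (hb h).2
    simp only [ENNReal.toReal_ofNat, Real.rpow_ofNat] at h2
    rw [h2]
    exact h3
  refine abs_le_of_sq_le_sq' ?_ (by positivity) |>.2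
  rw [mul_pow, Real.sq_sqrt hb0.le]
  exact h1

variable [CompleteSpace H]

open Classical in
/-- The analysis operator `T_f^*`, `h ↦ (⟨h, f i⟩)ᵢ` (zero if `f` is not Bessel). -/
def analysisOp (f : ι → H) : H →L[ℂ] Ell2 ι :=
  if hf : IsBessel f then
    (analysisLin f hf).mkContinuousOfExistsBound (analysisLin_bound f hf)
  else 0

/-- The synthesis operator `T_f`, `a ↦ ∑ a i • f i`. -/
def synthesisOp (f : ι → H) : Ell2 ι →L[ℂ] H :=
  ContinuousLinearMap.adjoint (analysisOp f)

/-- The synthesis operator of a Bessel sequence is given by the expected series. -/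
theorem hasSum_synthesisOp {f : ι → H} (hf : IsBessel f) (a : Ell2 ι) :
    HasSum (fun i => a i • f i) (synthesisOp f a) := by
  classical
  have h1 := (lp.hasSum_single (p := 2) (by norm_num) a).mapL (synthesisOp f)
  convert h1 using 2 with i
  refine ext_inner_right ℂ fun h => ?_
  rw [synthesisOp, ContinuousLinearMap.adjoint_inner_left, lp.inner_single_left,
    inner_smul_left, analysisOp, dif_pos hf]
  simp [analysisLin, mul_comm]

/-- The frame operator `S_f = T_f T_f^*`. -/
def frameOp (f : ι → H) : H →L[ℂ] H :=
  synthesisOp f ∘L ContinuousLinearMap.adjoint (synthesisOp f)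

/-- The set of oblique `V`-duals of a frame `f` for `W`: the Bessel sequences `g` in `V` such that
`h = ∑ ⟨h, g i⟩ f i` for every `h ∈ W`. -/
def obliqueDuals (V W : Submodule ℂ H) (f : ι → H) : Set (ι → H) :=
  {g | (∀ i, g i ∈ V) ∧ IsBessel g ∧ ∀ h ∈ W, HasSum (fun i => ⟪g i, h⟫_ℂ • f i) h}

/-- The four Penrose equations: `X` is the Moore-Penrose pseudo-inverse of `S`. -/
structure IsMoorePenrose (S X : H →L[ℂ] H) : Prop where
  eq₁ : S ∘L X ∘L S = S
  eq₂ : X ∘L S ∘L X = X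
  eq₃ : ContinuousLinearMap.adjoint (S ∘L X) = S ∘L X
  eq₄ : ContinuousLinearMap.adjoint (X ∘L S) = X ∘L S

open Classical in
/-- The Moore-Penrose pseudo-inverse of an operator; it exists, and is then unique, exactly when
the range is closed. -/
def moorePenrose (S : H →L[ℂ] H) : H →L[ℂ] H :=
  if h : ∃ X, IsMoorePenrose S X then h.choose else 0

/-- The canonical dual `S_f^† f i` of a frame `f` for a closed subspace. -/
def canonicalDual (f : ι → H) : ι → H := fun i => moorePenrose (frameOp f) (f i)

/-- The canonical oblique `V`-dual: the image of the canonical dual under the oblique projection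
onto `V` along `Wᗮ`. -/
def canonicalObliqueDual (V W : Submodule ℂ H) (hVW : IsCompl V Wᗮ) (f : ι → H) : ι → H :=
  fun i => V.projection Wᗮ hVW (canonicalDual f i)

end Frames

/-! ### Shift-invariant subspaces of `L²(ℝᵏ)` and their fibers -/

section Shifts

variable {k n : ℕ}

/-- The space `L²(ℝᵏ)` of complex valued functions. -/
abbrev L2R (k : ℕ) : Type := Lp ℂ 2 (volume : Measure (EuclideanSpace ℝ (Fin k)))

/-- The lattice point `ℓ ∈ ℤᵏ` as a vector of `ℝᵏ`. -/
def latticePt (ℓ : Fin k → ℤ) : EuclideanSpace ℝ (Fin k) := WithLp.toLp 2 fun j => (ℓ j : ℝ)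

/-- The translation `(T_ℓ f)(x) = f (x - ℓ)`. -/
def shiftBy (ℓ : Fin k → ℤ) (f : L2R k) : L2R k :=
  Lp.compMeasurePreserving (fun x => x - latticePt ℓ)
    (measurePreserving_sub_right volume (latticePt ℓ)) f

/-- The family `E(F) = {T_ℓ f_i}`. -/
def translates (F : Fin n → L2R k) : (Fin k → ℤ) × Fin n → L2R k :=
  fun p => shiftBy p.1 (F p.2)

/-- Finitely generated shift-invariant subspaces: the closed span of the integer translates of a
finite set. -/
def IsFSI (V : Submodule ℂ (L2R k)) : Prop :=
  ∃ A : Set (L2R k), A.Finite ∧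
    V = (Submodule.span ℂ {g | ∃ f ∈ A, ∃ ℓ : Fin k → ℤ, g = shiftBy ℓ f}).topologicalClosure

/-- Shift preserving operators. -/
def IsShiftPreserving (S : L2R k →L[ℂ] L2R k) : Prop :=
  ∀ (ℓ : Fin k → ℤ) (f : L2R k), shiftBy ℓ (S f) = S (shiftBy ℓ f)

/-- The torus `[-1/2, 1/2)ᵏ`. -/
def torus (k : ℕ) : Set (EuclideanSpace ℝ (Fin k)) :=
  {x | ∀ j, x j ∈ Set.Ico (-(1 / 2) : ℝ) (1 / 2)}

/-- Lebesgue measure on the torus. -/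
def torusMeasure (k : ℕ) : Measure (EuclideanSpace ℝ (Fin k)) := volume.restrict (torus k)

open Classical in
/-- The fiber `Γ f x = (f̂ (x + ℓ))_ℓ ∈ ℓ²(ℤᵏ)`; the sequence is square summable for almost
every `x`, and on the remaining null set the value is `0`. -/
def fiberization (f : L2R k) (x : EuclideanSpace ℝ (Fin k)) : Ell2 (Fin k → ℤ) :=
  if h : Memℓp (fun ℓ : Fin k → ℤ => (𝓕 f : L2R k) (x + latticePt ℓ)) 2 then ⟨_, h⟩ else 0

/-- `J` is a measurable range function and
`V = {f | Γ f x ∈ J x for almost every x in the torus}`. Measurability is with respect to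
Lebesgue measurable sets. -/
structure IsRangeFunction (V : Submodule ℂ (L2R k))
    (J : EuclideanSpace ℝ (Fin k) → ClosedSubmodule ℂ (Ell2 (Fin k → ℤ))) : Prop where
  measurable : ∀ ξ η : Ell2 (Fin k → ℤ),
    AEMeasurable (fun x => ⟪η, (J x).toSubmodule.starProjection ξ⟫_ℂ) (torusMeasure k)
  mem_iff : ∀ f : L2R k, f ∈ V ↔ ∀ᵐ x ∂torusMeasure k, fiberization f x ∈ J x

open Classical in
/-- The range function `J_V` of a shift-invariant subspace `V`. It exists for each such `V` and
is unique up to a null set. -/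
def rangeFunction (V : Submodule ℂ (L2R k)) :
    EuclideanSpace ℝ (Fin k) → ClosedSubmodule ℂ (Ell2 (Fin k → ℤ)) :=
  if h : ∃ J, IsRangeFunction V J then h.choose else fun _ => ⊥

/-- `s` is a weakly measurable, essentially bounded field of operators on `ℓ²(ℤᵏ)` with
`s x (Γ f x) = Γ (S f) x` for almost every `x` in the torus, for each `f`. -/
structure IsFiberField (S : L2R k →L[ℂ] L2R k)
    (s : EuclideanSpace ℝ (Fin k) → Ell2 (Fin k → ℤ) →L[ℂ] Ell2 (Fin k → ℤ)) : Prop where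
  measurable : ∀ ξ η : Ell2 (Fin k → ℤ), AEMeasurable (fun x => ⟪η, s x ξ⟫_ℂ) (torusMeasure k)
  bounded : ∃ C : ℝ, ∀ᵐ x ∂torusMeasure k, ‖s x‖ ≤ C
  intertwines : ∀ f : L2R k, ∀ᵐ x ∂torusMeasure k, s x (fiberization f x) = fiberization (S f) x

open Classical in
/-- The field of operators `[S]` of a shift preserving operator `S`. It exists for each such `S`
and is unique up to a null set. -/
def fiberField (S : L2R k →L[ℂ] L2R k) :
    EuclideanSpace ℝ (Fin k) → Ell2 (Fin k → ℤ) →L[ℂ] Ell2 (Fin k → ℤ) :=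
  if h : ∃ s, IsFiberField S s then h.choose else fun _ => 0

/-- The oblique `V`-duals of `E(F)` of the form `E(G)`, `G` a finite sequence in `V`. -/
def shiftGeneratedDuals (V W : Submodule ℂ (L2R k)) (F : Fin n → L2R k) :
    Set ((Fin k → ℤ) × Fin n → L2R k) :=
  {g | g ∈ obliqueDuals V W (translates F) ∧
    ∃ G : Fin n → L2R k, (∀ i, G i ∈ V) ∧ g = translates G}

/-- The additive model `U_V(g)` of a family `g = E(G)` with `n` generators: the operators
`S_g + B` with `B` positive, shift preserving, with range in `V`, and
`rank [B]_x ≤ n - dim J_V(x)` for almost every `x` (written as an inequality of cardinals that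
involves no subtraction). -/
def additiveModel (V : Submodule ℂ (L2R k)) (g : (Fin k → ℤ) × Fin n → L2R k) :
    Set (L2R k →L[ℂ] L2R k) :=
  {S | ∃ B : L2R k →L[ℂ] L2R k, B.IsPositive ∧ IsShiftPreserving B ∧ (∀ f, B f ∈ V) ∧
    (∀ᵐ x ∂torusMeasure k,
      (fiberField B x : Ell2 (Fin k → ℤ) →ₗ[ℂ] Ell2 (Fin k → ℤ)).rank +
        Module.rank ℂ (rangeFunction V x).toSubmodule ≤ (n : Cardinal)) ∧
    S = frameOp g + B}

end Shifts

end

/-! Write `P` for the oblique projection onto `V` along `Wᗮ`, `T_f` for synthesis, and `φ = P S† F`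
for the generators of the canonical dual. `P` and the pseudo-inverse `S†` commute with lattice
translations, so `P S†` maps `E(F)` to `E(φ)`; this is the first claim.

Taking adjoints, a Bessel family `g` in `V` is a dual exactly when `T_g T_F^* = P`
(`mem_obliqueDuals_iff`). `E(φ)` satisfies this, so the shift-generated duals are the `E(φ + R)`
with `R` in `V` and `T_R T_F^* = 0`. Since `T_φ = P S† T_F`, the cross terms vanish and `S_{φ+R} =
S_φ + S_R` (`frameOp_canonicalObliqueDual_add`). It remains to decide which `B` are of the form
`S_R`.

Fourier series on the cube turn `T_R T_G^*` into the field `v ↦ ∑ ⟨Γ Gᵢ x, v⟩ Γ Rᵢ x`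
(`fiberization_synthesisOp_analysisOp`), and `J_V(x)` is the span of the `Γ φᵢ x`
(`isRangeFunction_fiberSpan`). Put `M(x) = (⟨Γ Fᵢ x, Γ φⱼ x⟩)`.

Necessity of the rank bound: the transpose of `M(x)` reproduces the vectors `Γ φᵢ x` and annihilates
the `Γ Rᵢ x`, so the dimensions of the two spans add up to at most `n`
(`finrank_span_add_finrank_span_le`).

Sufficiency: `M(x)` is an orthogonal projection of rank at most `d(x)`, and `β(x) = (⟨Γ Fᵢ x, Γ(B
Fⱼ) x⟩)` is positive semidefinite of rank at most `rank [B]_x`, hence at most `rank (1 - M(x))`. So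
`β = C C*` for some `C` with `C M = 0`. Setting `Γ Rⱼ = ∑ᵢ Cᵢⱼ Γ φᵢ` gives `T_R T_F^* = 0` and `S_R
= P B P* = B`. A pivoted Cholesky scheme applied to `β` and `1 - M` simultaneously yields such a `C`
by an explicit formula, so it depends measurably on `x` (`pivotFactor_spec`,
`measurable_pivotFactor`). -/

set_option linter.unusedSectionVars false

/-! ### Bessel families, pseudo-inverses and oblique duals in a Hilbert space -/

section HilbertFrames

variable {ι H : Type} [NormedAddCommGroup H] [InnerProductSpace ℂ H] [CompleteSpace H]

theorem analysisOp_apply {f : ι → H} (hf : IsBessel f) (h : H) (i : ι) :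
    analysisOp f h i = ⟪f i, h⟫_ℂ := by
  rw [analysisOp, dif_pos hf]
  rfl

theorem adjoint_synthesisOp (f : ι → H) :
    ContinuousLinearMap.adjoint (synthesisOp f) = analysisOp f :=
  ContinuousLinearMap.adjoint_adjoint _

theorem frameOp_eq (f : ι → H) : frameOp f = synthesisOp f ∘L analysisOp f := by
  rw [frameOp, adjoint_synthesisOp]

theorem IsBessel.map {f : ι → H} (hf : IsBessel f) (T : H →L[ℂ] H) :
    IsBessel (fun i => T (f i)) := by
  obtain ⟨b, hb0, hb⟩ := hf
  refine ⟨b * (‖ContinuousLinearMap.adjoint T‖ ^ 2 + 1), by positivity, fun h => ?_⟩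
  have h1 := hb (ContinuousLinearMap.adjoint T h)
  simp only [ContinuousLinearMap.adjoint_inner_right] at h1
  refine ⟨h1.1, h1.2.trans ?_⟩
  have h2 : ‖ContinuousLinearMap.adjoint T h‖ ^ 2 ≤
      (‖ContinuousLinearMap.adjoint T‖ * ‖h‖) ^ 2 := by
    gcongr
    exact ContinuousLinearMap.le_opNorm _ _
  calc _ ≤ b * (‖ContinuousLinearMap.adjoint T‖ * ‖h‖) ^ 2 := by gcongr
    _ ≤ _ := by nlinarith [mul_nonneg hb0.le (sq_nonneg ‖h‖)]

theorem IsBessel.add {f g : ι → H} (hf : IsBessel f) (hg : IsBessel g) :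
    IsBessel (fun i => f i + g i) := by
  obtain ⟨b, hb0, hb⟩ := hf
  obtain ⟨c, hc0, hc⟩ := hg
  refine ⟨2 * b + 2 * c, by positivity, fun h => ?_⟩
  have key : ∀ i, ‖⟪f i + g i, h⟫_ℂ‖ ^ 2 ≤ 2 * ‖⟪f i, h⟫_ℂ‖ ^ 2 + 2 * ‖⟪g i, h⟫_ℂ‖ ^ 2 := by
    intro i
    rw [inner_add_left]
    have := norm_add_le ⟪f i, h⟫_ℂ ⟪g i, h⟫_ℂ
    nlinarith [norm_nonneg (⟪f i, h⟫_ℂ + ⟪g i, h⟫_ℂ), sq_nonneg (‖⟪f i, h⟫_ℂ‖ - ‖⟪g i, h⟫_ℂ‖)]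
  have hs := ((hb h).1.mul_left 2).add ((hc h).1.mul_left 2)
  have hs' := hs.of_nonneg_of_le (fun i => by positivity) key
  refine ⟨hs', (hs'.tsum_le_tsum key hs).trans ?_⟩
  rw [((hb h).1.mul_left 2).tsum_add ((hc h).1.mul_left 2), tsum_mul_left, tsum_mul_left]
  nlinarith [(hb h).2, (hc h).2]

theorem IsBessel.sub {f g : ι → H} (hf : IsBessel f) (hg : IsBessel g) :
    IsBessel (fun i => f i - g i) := by
  have := hf.add (hg.map (-1))
  simpa [sub_eq_add_neg] using this

theorem analysisOp_map {f : ι → H} (hf : IsBessel f) (T : H →L[ℂ] H) :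
    analysisOp (fun i => T (f i)) = analysisOp f ∘L ContinuousLinearMap.adjoint T := by
  ext h i
  simp [analysisOp_apply hf, analysisOp_apply (hf.map T), ContinuousLinearMap.adjoint_inner_right]

theorem synthesisOp_map {f : ι → H} (hf : IsBessel f) (T : H →L[ℂ] H) :
    synthesisOp (fun i => T (f i)) = T ∘L synthesisOp f := by
  rw [synthesisOp, analysisOp_map hf, ContinuousLinearMap.adjoint_comp,
    ContinuousLinearMap.adjoint_adjoint, synthesisOp]

theorem analysisOp_add {f g : ι → H} (hf : IsBessel f) (hg : IsBessel g) :
    analysisOp (fun i => f i + g i) = analysisOp f + analysisOp g := by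
  ext h i
  simp [analysisOp_apply hf, analysisOp_apply hg, analysisOp_apply (hf.add hg)]

theorem synthesisOp_add {f g : ι → H} (hf : IsBessel f) (hg : IsBessel g) :
    synthesisOp (fun i => f i + g i) = synthesisOp f + synthesisOp g := by
  rw [synthesisOp, analysisOp_add hf hg, map_add, synthesisOp, synthesisOp]

theorem adjoint_synthesisOp_comp_analysisOp (f g : ι → H) :
    ContinuousLinearMap.adjoint (synthesisOp f ∘L analysisOp g) =
      synthesisOp g ∘L analysisOp f := by
  rw [ContinuousLinearMap.adjoint_comp, adjoint_synthesisOp, synthesisOp]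

theorem hasSum_synthesisOp_analysisOp {f g : ι → H} (hf : IsBessel f) (hg : IsBessel g) (h : H) :
    HasSum (fun i => ⟪g i, h⟫_ℂ • f i) (synthesisOp f (analysisOp g h)) := by
  simpa only [analysisOp_apply hg] using hasSum_synthesisOp hf (analysisOp g h)

theorem synthesisOp_mem {V : Submodule ℂ H} (hV : IsClosed (V : Set H)) {f : ι → H}
    (hf : IsBessel f) (hfV : ∀ i, f i ∈ V) (a : Ell2 ι) : synthesisOp f a ∈ V :=
  hV.mem_of_tendsto (hasSum_synthesisOp hf a)
    (Filter.Eventually.of_forall fun _ => V.sum_mem fun i _ => V.smul_mem _ (hfV i))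

theorem frameOp_isPositive (f : ι → H) : (frameOp f).IsPositive := by
  rw [frameOp]
  exact ContinuousLinearMap.isPositive_self_comp_adjoint _

theorem inner_frameOp_self {f : ι → H} (hf : IsBessel f) (h : H) :
    ⟪frameOp f h, h⟫_ℂ = ((∑' i, ‖⟪f i, h⟫_ℂ‖ ^ 2 : ℝ) : ℂ) := by
  rw [frameOp_eq, ContinuousLinearMap.comp_apply, synthesisOp,
    ContinuousLinearMap.adjoint_inner_left, inner_self_eq_norm_sq_to_K]
  have h2 := lp.norm_rpow_eq_tsum (p := 2) (by norm_num) (analysisOp f h)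
  simp only [ENNReal.toReal_ofNat, Real.rpow_ofNat, analysisOp_apply hf] at h2
  rw [← h2]
  push_cast
  rfl

/-- `S X` and `S Y` are self-adjoint and each absorbs the other, hence they agree; likewise `X S`
and `Y S`. Then `X = X S X = X S Y = Y S Y = Y`. Uniqueness makes the choice in `moorePenrose`
harmless. -/
theorem IsMoorePenrose.unique {S X Y : H →L[ℂ] H} (hX : IsMoorePenrose S X)
    (hY : IsMoorePenrose S Y) : X = Y := by
  obtain ⟨a1, a2, a3, a4⟩ := hX
  obtain ⟨b1, b2, b3, b4⟩ := hY
  simp only [← ContinuousLinearMap.mul_def, ← ContinuousLinearMap.star_eq_adjoint] at *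
  have e1 : S * X = S * Y := calc
    S * X = star (S * X) := a3.symm
    _ = star ((S * Y) * (S * X)) := by rw [mul_assoc, ← mul_assoc Y, ← mul_assoc, ← mul_assoc S Y,
          mul_assoc S Y S, b1]
    _ = (S * X) * (S * Y) := by rw [star_mul, a3, b3]
    _ = S * Y := by rw [← mul_assoc, mul_assoc S X S, a1]
  have e2 : X * S = Y * S := calc
    X * S = X * S * (Y * S) := by rw [← mul_assoc, mul_assoc X S Y, mul_assoc X, mul_assoc S Y, b1]
    _ = star ((Y * S) * (X * S)) := by rw [star_mul, a4, b4]
    _ = star (Y * S) := by rw [← mul_assoc, mul_assoc Y S X, mul_assoc Y, mul_assoc S X, a1]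
    _ = Y * S := b4
  calc X = X * (S * X) := a2.symm
    _ = X * S * Y := by rw [e1, mul_assoc]
    _ = Y * (S * Y) := by rw [e2, mul_assoc]
    _ = Y := b2

theorem moorePenrose_eq {S X : H →L[ℂ] H} (hX : IsMoorePenrose S X) : moorePenrose S = X := by
  have h : ∃ X, IsMoorePenrose S X := ⟨X, hX⟩
  rw [moorePenrose, dif_pos h]
  exact h.choose_spec.unique hX

section FrameFor

variable {W : Submodule ℂ H} [W.HasOrthogonalProjection] {f : ι → H}

/-- The frame inequalities hold only on `W`, but `f i ∈ W` makes `⟨f i, u⟩` depend only on the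
orthogonal projection of `u` to `W`. -/
theorem IsFrameFor.isBessel (hf : IsFrameFor W f) : IsBessel f := by
  obtain ⟨hfW, a, b, ha, hab, h⟩ := hf
  refine ⟨b, ha.trans_le hab, fun u => ?_⟩
  have h1 := h (W.starProjection u) (W.starProjection_apply_mem u)
  have h2 : ∀ i, ⟪f i, W.starProjection u⟫_ℂ = ⟪f i, u⟫_ℂ := fun i => by
    rw [← Submodule.inner_starProjection_left_eq_right,
      Submodule.starProjection_eq_self_iff.mpr (hfW i)]
  simp only [h2] at h1
  refine ⟨h1.1, h1.2.2.trans ?_⟩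
  have := W.norm_starProjection_apply_le u
  have := ha.trans_le hab
  gcongr

/-- With `p` the orthogonal projection onto `W`, the operator `S + (1 - p)` is coercive: `S` is
bounded below on `W` by the lower frame bound `a`, and `1 - p` is the identity on `Wᗮ`. Its inverse
`v` satisfies `S v = v S = p`, so `v p` is the pseudo-inverse. -/
theorem exists_isMoorePenrose_frameOp (hf : IsFrameFor W f) :
    ∃ X : H →L[ℂ] H, IsMoorePenrose (frameOp f) X ∧ IsSelfAdjoint X ∧
      X * frameOp f = W.starProjection ∧ W.starProjection * X = X := by
  have hB := hf.isBessel
  set S := frameOp f with hS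
  set p := W.starProjection with hp
  have hpp : p * p = p := W.isIdempotentElem_starProjection
  have hps : star p = p := isSelfAdjoint_starProjection W
  have hSs : star S = S := (frameOp_isPositive f).isSelfAdjoint
  have hpS : p * S = S := by
    ext h
    refine Submodule.starProjection_eq_self_iff.mpr ?_
    rw [hS, frameOp_eq]
    exact synthesisOp_mem (W.orthogonal_orthogonal ▸ Wᗮ.isClosed_orthogonal) hB hf.1 _
  have hSp : S * p = S := by
    have := congrArg star hpS
    rwa [star_mul, hps, hSs] at this
  obtain ⟨hfW, a, b, ha, hab, hfr⟩ := id hf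
  have hu : IsUnit (S + (1 - p)) := by
    refine ContinuousLinearMap.isUnit_of_forall_le_norm_inner_map _
      (c := ⟨min a 1, by positivity⟩) (lt_min ha one_pos) fun x => ?_
    have e1 : ⟪S x, x⟫_ℂ = ((∑' i, ‖⟪f i, p x⟫_ℂ‖ ^ 2 : ℝ) : ℂ) := by
      rw [← inner_frameOp_self hB, ← hS]
      have h1 : S x = S (p x) := by exact (congrArg (fun T : H →L[ℂ] H => T x) hSp).symm
      have h2 : S (p x) = p (S (p x)) := by exact (congrArg (fun T : H →L[ℂ] H => T (p x)) hpS).symm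
      rw [h1, h2, W.inner_starProjection_left_eq_right, ← h2]
    have e2 : ⟪x - p x, x⟫_ℂ = ((‖x - p x‖ ^ 2 : ℝ) : ℂ) := by
      have h0 : ⟪x - p x, p x⟫_ℂ = 0 := by
        have h3 := W.sub_starProjection_mem_orthogonal x
        exact (Submodule.mem_orthogonal' _ _).mp h3 _ (W.starProjection_apply_mem x)
      conv_lhs => enter [3]; rw [← sub_add_cancel x (p x)]
      rw [inner_add_right, h0, add_zero, inner_self_eq_norm_sq_to_K]
      push_cast
      rfl
    have e3 : ‖x‖ ^ 2 = ‖p x‖ ^ 2 + ‖x - p x‖ ^ 2 := by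
      have h0 : ⟪p x, x - p x⟫_ℂ = 0 := by
        have h3 := W.sub_starProjection_mem_orthogonal x
        exact (Submodule.mem_orthogonal _ _).mp h3 _ (W.starProjection_apply_mem x)
      have := norm_add_sq_eq_norm_sq_add_norm_sq_of_inner_eq_zero _ _ h0
      rw [add_sub_cancel] at this
      nlinarith [this]
    have e4 : ⟪(S + (1 - p)) x, x⟫_ℂ =
        ((∑' i, ‖⟪f i, p x⟫_ℂ‖ ^ 2 + ‖x - p x‖ ^ 2 : ℝ) : ℂ) := by
      simp only [_root_.add_apply, _root_.sub_apply,
        one_apply_eq_self, inner_add_left, e1, e2]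
      push_cast
      rfl
    have h5 := (hfr (p x) (W.starProjection_apply_mem x)).2.1
    have h6 : 0 ≤ ∑' i, ‖⟪f i, p x⟫_ℂ‖ ^ 2 := tsum_nonneg fun i => by positivity
    rw [e4, Complex.norm_real, Real.norm_of_nonneg (by positivity), e3]
    change (‖p x‖ ^ 2 + ‖x - p x‖ ^ 2) * min a 1 ≤ _
    have h7 : ‖p x‖ ^ 2 * min a 1 ≤ ‖p x‖ ^ 2 * a := by gcongr; exact min_le_left _ _
    have h8 : ‖x - p x‖ ^ 2 * min a 1 ≤ ‖x - p x‖ ^ 2 * 1 := by gcongr; exact min_le_right _ _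
    linarith
  obtain ⟨u, hu⟩ := hu
  set v : H →L[ℂ] H := ↑u⁻¹ with hv
  have huv : (S + (1 - p)) * v = 1 := by rw [← hu]; exact u.mul_inv
  have hvu : v * (S + (1 - p)) = 1 := by rw [← hu]; exact u.inv_mul
  have hus : star (S + (1 - p)) = S + (1 - p) := by simp [hSs, hps]
  have hvs : star v = v := by
    have h1 : (S + (1 - p)) * star v = 1 := by
      have := congrArg star hvu
      rwa [star_mul, hus, star_one] at this
    calc star v = v * (S + (1 - p)) * star v := by rw [hvu, one_mul]
      _ = v := by rw [mul_assoc, h1, mul_one]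
  have hpu : p * (S + (1 - p)) = S := by rw [mul_add, hpS, mul_sub, mul_one, hpp]; simp
  have hup : (S + (1 - p)) * p = S := by rw [add_mul, hSp, sub_mul, one_mul, hpp]; simp
  have hSv : S * v = p := by rw [← hpu, mul_assoc, huv, mul_one]
  have hvS : v * S = p := by rw [← hup, ← mul_assoc, hvu, one_mul]
  have hvp : v * p = p * v := calc
    v * p = v * (S * v) := by rw [hSv]
    _ = p * v := by rw [← mul_assoc, hvS]
  refine ⟨v * p, ⟨?_, ?_, ?_, ?_⟩, ?_, ?_, ?_⟩
  · change S * (v * p * S) = S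
    rw [mul_assoc v, hpS, hvS, hSp]
  · change v * p * (S * (v * p)) = v * p
    rw [← mul_assoc S, hSv, hpp, mul_assoc, hpp]
  · change star (S * (v * p)) = S * (v * p)
    rw [← mul_assoc, hSv, hpp, hps]
  · change star (v * p * S) = v * p * S
    rw [mul_assoc, hpS, hvS, hps]
  · change star (v * p) = v * p
    rw [star_mul, hps, hvs, hvp]
  · rw [mul_assoc, hpS, hvS]
  · rw [← mul_assoc, ← hvp, mul_assoc, hpp]

theorem moorePenrose_frameOp (hf : IsFrameFor W f) :
    IsMoorePenrose (frameOp f) (moorePenrose (frameOp f)) ∧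
      IsSelfAdjoint (moorePenrose (frameOp f)) ∧
      moorePenrose (frameOp f) * frameOp f = W.starProjection ∧
      W.starProjection * moorePenrose (frameOp f) = moorePenrose (frameOp f) := by
  obtain ⟨X, hX, h⟩ := exists_isMoorePenrose_frameOp hf
  rw [moorePenrose_eq hX]
  exact ⟨hX, h⟩

end FrameFor

/-- A Moore-Penrose inverse commutes with every unitary that commutes with the operator. -/
theorem IsMoorePenrose.commute_of_unitary {S X u : H →L[ℂ] H} (hX : IsMoorePenrose S X)
    (hu : u ∈ unitary (H →L[ℂ] H)) (hSu : Commute S u) : Commute X u := by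
  have h1 : star u * u = 1 := (Unitary.mem_iff.mp hu).1
  have h2 : u * star u = 1 := (Unitary.mem_iff.mp hu).2
  have hSu' : S * u = u * S := hSu
  have hSu2 : star u * S = S * star u := by
    calc star u * S = star u * (S * u) * star u := by rw [mul_assoc, mul_assoc, h2, mul_one]
      _ = S * star u := by rw [hSu', ← mul_assoc, h1, one_mul]
  have e1 : S * (star u * X * u) = star u * (S * X) * u := by
    rw [← mul_assoc, ← mul_assoc, ← hSu2, mul_assoc (star u) S X]
  have e2 : star u * X * u * S = star u * (X * S) * u := by
    rw [mul_assoc, ← hSu', ← mul_assoc, mul_assoc (star u) X S]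
  -- Conjugation by `u` fixes `S`, so it turns the four equations for `X` into those for `u* X u`;
  -- uniqueness then gives `X = u* X u`.
  have hY : IsMoorePenrose S (star u * X * u) := by
    obtain ⟨a1, a2, a3, a4⟩ := hX
    simp only [← ContinuousLinearMap.mul_def, ← ContinuousLinearMap.star_eq_adjoint] at *
    refine ⟨?_, ?_, ?_, ?_⟩ <;>
      simp only [← ContinuousLinearMap.mul_def, ← ContinuousLinearMap.star_eq_adjoint]
    · rw [← mul_assoc, e1, mul_assoc, ← hSu', ← mul_assoc, mul_assoc (star u), mul_assoc S X S, a1,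
        hSu2, mul_assoc, h1, mul_one]
    · rw [← mul_assoc, e2, mul_assoc, ← mul_assoc u, ← mul_assoc u, h2, one_mul, ← mul_assoc,
        mul_assoc (star u), mul_assoc X S X, a2]
    · rw [e1, star_mul, star_mul, star_star, a3, ← mul_assoc]
    · rw [e2, star_mul, star_mul, star_star, a4, ← mul_assoc]
  have := hX.unique hY
  change X * u = u * X
  conv_rhs => rw [this, ← mul_assoc, ← mul_assoc, h2, one_mul]

/-! ### Oblique projections and the structure of oblique duals -/

section Oblique

variable {V W : Submodule ℂ H} [W.HasOrthogonalProjection] {f : ι → H}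

/-- The oblique projection onto `V` along `Wᗮ` as a bounded operator. -/
noncomputable def obliqueProj (V W : Submodule ℂ H) (hV : IsClosed (V : Set H))
    (hVW : IsCompl V Wᗮ) : H →L[ℂ] H :=
  V.projectionL Wᗮ (Submodule.IsCompl.isTopCompl_of_isClosed hVW hV W.isClosed_orthogonal)

theorem obliqueProj_apply (hV : IsClosed (V : Set H)) (hVW : IsCompl V Wᗮ) (x : H) :
    obliqueProj V W hV hVW x = V.projection Wᗮ hVW x := rfl

theorem obliqueProj_mem (hV : IsClosed (V : Set H)) (hVW : IsCompl V Wᗮ) (x : H) :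
    obliqueProj V W hV hVW x ∈ V := by simp [obliqueProj_apply]

theorem obliqueProj_of_mem (hV : IsClosed (V : Set H)) (hVW : IsCompl V Wᗮ) {x : H} (hx : x ∈ V) :
    obliqueProj V W hV hVW x = x :=
  Submodule.projection_apply_of_mem_left hVW hx

theorem sub_obliqueProj_mem (hV : IsClosed (V : Set H)) (hVW : IsCompl V Wᗮ) (x : H) :
    x - obliqueProj V W hV hVW x ∈ Wᗮ := by
  rw [← Submodule.projection_apply_eq_zero_iff hVW, map_sub, ← obliqueProj_apply hV,
    ← obliqueProj_apply hV, obliqueProj_of_mem hV hVW (obliqueProj_mem hV hVW x), sub_self]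

theorem inner_obliqueProj (hV : IsClosed (V : Set H)) (hVW : IsCompl V Wᗮ) {w : H} (hw : w ∈ W)
    (x : H) : ⟪w, obliqueProj V W hV hVW x⟫_ℂ = ⟪w, x⟫_ℂ := by
  have := (Submodule.mem_orthogonal _ _).mp (sub_obliqueProj_mem hV hVW x) w hw
  rw [inner_sub_right, sub_eq_zero] at this
  exact this.symm

theorem canonicalObliqueDual_eq (hV : IsClosed (V : Set H)) (hVW : IsCompl V Wᗮ) (f : ι → H) :
    canonicalObliqueDual V W hVW f =
      fun i => (obliqueProj V W hV hVW * moorePenrose (frameOp f)) (f i) := rfl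

theorem canonicalObliqueDual_isBessel (hV : IsClosed (V : Set H)) (hVW : IsCompl V Wᗮ)
    (hf : IsFrameFor W f) : IsBessel (canonicalObliqueDual V W hVW f) := by
  rw [canonicalObliqueDual_eq hV]
  exact hf.isBessel.map _

theorem canonicalObliqueDual_mem (hV : IsClosed (V : Set H)) (hVW : IsCompl V Wᗮ) (i : ι) :
    canonicalObliqueDual V W hVW f i ∈ V :=
  obliqueProj_mem hV hVW _

/-- Both sides differ by the oblique projection of a vector of `Wᗮ`, which is zero. -/
theorem obliqueProj_comp_starProjection (hV : IsClosed (V : Set H)) (hVW : IsCompl V Wᗮ) :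
    obliqueProj V W hV hVW * W.starProjection = obliqueProj V W hV hVW := by
  ext x
  have h1 := W.sub_starProjection_mem_orthogonal x
  rw [← Submodule.projection_apply_eq_zero_iff hVW, map_sub, sub_eq_zero] at h1
  exact h1.symm

theorem synthesisOp_canonicalObliqueDual_comp (hV : IsClosed (V : Set H)) (hVW : IsCompl V Wᗮ)
    (hf : IsFrameFor W f) :
    synthesisOp (canonicalObliqueDual V W hVW f) ∘L analysisOp f = obliqueProj V W hV hVW := by
  rw [canonicalObliqueDual_eq hV, synthesisOp_map hf.isBessel]
  change (obliqueProj V W hV hVW * moorePenrose (frameOp f)) * (synthesisOp f ∘L analysisOp f) = _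
  rw [← frameOp_eq, mul_assoc, (moorePenrose_frameOp hf).2.2.1, obliqueProj_comp_starProjection]

/-- The reconstruction formula is `T_f T_g^* = id` on `W`. By duality it says that `T_g T_f^* x - P
x` is orthogonal to `W`; this vector also lies in `V`, and `V ∩ Wᗮ = 0`. -/
theorem mem_obliqueDuals_iff (hV : IsClosed (V : Set H)) (hVW : IsCompl V Wᗮ)
    (hf : IsFrameFor W f) (g : ι → H) :
    g ∈ obliqueDuals V W f ↔ (∀ i, g i ∈ V) ∧ IsBessel g ∧
      synthesisOp g ∘L analysisOp f = obliqueProj V W hV hVW := by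
  refine and_congr_right fun hgV => and_congr_right fun hg => ⟨fun h => ?_, fun h w hw => ?_⟩
  · have h1 : ∀ w ∈ W, synthesisOp f (analysisOp g w) = w := fun w hw =>
      (hasSum_synthesisOp_analysisOp hf.isBessel hg w).unique (h w hw)
    ext x
    have hm := synthesisOp_mem hV hg hgV (analysisOp f x)
    have hd : synthesisOp g (analysisOp f x) - obliqueProj V W hV hVW x ∈ Wᗮ := by
      rw [Submodule.mem_orthogonal]
      intro w hw
      rw [inner_sub_right, inner_obliqueProj hV hVW hw, ← ContinuousLinearMap.comp_apply,
        ← ContinuousLinearMap.adjoint_inner_left, adjoint_synthesisOp_comp_analysisOp,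
        ContinuousLinearMap.comp_apply, h1 w hw, sub_self]
    have := (Submodule.disjoint_def.mp hVW.disjoint) _
      (V.sub_mem hm (obliqueProj_mem hV hVW x)) hd
    exact sub_eq_zero.mp this
  · have h1 : synthesisOp f (analysisOp g w) = w := by
      refine ext_inner_right ℂ fun x => ?_
      rw [← ContinuousLinearMap.comp_apply, ← adjoint_synthesisOp_comp_analysisOp, h,
        ContinuousLinearMap.adjoint_inner_left, inner_obliqueProj hV hVW hw]
    have := hasSum_synthesisOp_analysisOp hf.isBessel hg w
    rwa [h1] at this

/-- The synthesis operator of the canonical dual is `P S†` composed with that of `f`, so it kills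
the range of the analysis operator of `r`. Hence both cross terms in the expansion are zero. -/
theorem frameOp_canonicalObliqueDual_add (hV : IsClosed (V : Set H)) (hVW : IsCompl V Wᗮ)
    (hf : IsFrameFor W f) {r : ι → H} (hr : IsBessel r)
    (hrf : synthesisOp r ∘L analysisOp f = 0) :
    frameOp (fun i => canonicalObliqueDual V W hVW f i + r i) =
      frameOp (canonicalObliqueDual V W hVW f) + frameOp r := by
  have hφ := canonicalObliqueDual_isBessel hV hVW hf
  have hfr : synthesisOp f ∘L analysisOp r = 0 := by
    rw [← adjoint_synthesisOp_comp_analysisOp, hrf, map_zero]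
  have h1 : synthesisOp (canonicalObliqueDual V W hVW f) ∘L analysisOp r = 0 := by
    rw [canonicalObliqueDual_eq hV, synthesisOp_map hf.isBessel, ContinuousLinearMap.comp_assoc,
      hfr, ContinuousLinearMap.comp_zero]
  have h2 : synthesisOp r ∘L analysisOp (canonicalObliqueDual V W hVW f) = 0 := by
    rw [← adjoint_synthesisOp_comp_analysisOp, h1, map_zero]
  rw [frameOp_eq, frameOp_eq, frameOp_eq, analysisOp_add hφ hr, synthesisOp_add hφ hr,
    ContinuousLinearMap.add_comp, ContinuousLinearMap.comp_add, ContinuousLinearMap.comp_add, h1,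
    h2, add_zero, zero_add]

end Oblique

end HilbertFrames

/-! ### A measurable pivoted Cholesky factorization -/

section PivotedFactorization

open Matrix
open scoped ComplexOrder

variable {n : ℕ}

open Classical in
/-- The first pivot column of a positive semidefinite matrix, normalized as in the Cholesky
factorization; it is zero if all diagonal entries vanish. -/
noncomputable def pivotCol (A : Matrix (Fin n) (Fin n) ℂ) : Fin n → ℂ :=
  ∑ i, if (∀ j < i, A j j = 0) ∧ A i i ≠ 0 then ((Real.sqrt (A i i).re : ℂ)⁻¹) • A.col i else 0

/-- Subtraction of the first pivot. -/
noncomputable def pivotRem (A : Matrix (Fin n) (Fin n) ℂ) : Matrix (Fin n) (Fin n) ℂ :=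
  A - vecMulVec (pivotCol A) (star (pivotCol A))

/-- The matrix `∑ zⱼ uⱼ*` where `zⱼ` and `uⱼ` are the first `m` pivot columns of `A` and `Q`. -/
noncomputable def pivotFactor :
    ℕ → Matrix (Fin n) (Fin n) ℂ → Matrix (Fin n) (Fin n) ℂ → Matrix (Fin n) (Fin n) ℂ
  | 0, _, _ => 0
  | m + 1, A, Q => vecMulVec (pivotCol A) (star (pivotCol Q)) +
      pivotFactor m (pivotRem A) (pivotRem Q)

/-- At most one index meets the condition in `pivotCol`, so the sum there merely selects. This
closed form, with no choice of basis, is what keeps the construction measurable in a parameter. -/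
theorem pivotCol_eq {A : Matrix (Fin n) (Fin n) ℂ} {i : Fin n} (hi : ∀ j < i, A j j = 0)
    (hi' : A i i ≠ 0) : pivotCol A = ((Real.sqrt (A i i).re : ℂ)⁻¹) • A.col i := by
  classical
  rw [pivotCol, Finset.sum_eq_single i, if_pos ⟨hi, hi'⟩]
  · intro j _ hj
    rw [if_neg]
    rintro ⟨h1, h2⟩
    rcases lt_or_gt_of_ne hj with h | h
    · exact h2 (hi j h)
    · exact hi' (h1 i h)
  · simp

theorem pivotCol_zero : pivotCol (0 : Matrix (Fin n) (Fin n) ℂ) = 0 := by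
  simp [pivotCol]

theorem pivotRem_zero : pivotRem (0 : Matrix (Fin n) (Fin n) ℂ) = 0 := by
  ext; simp [pivotRem, pivotCol_zero, vecMulVec]

theorem exists_pivot {A : Matrix (Fin n) (Fin n) ℂ} (hA : A.PosSemidef) (h0 : A ≠ 0) :
    ∃ i, (∀ j < i, A j j = 0) ∧ A i i ≠ 0 := by
  classical
  have hex : ∃ i, A i i ≠ 0 := by
    by_contra! h
    exact h0 (hA.trace_eq_zero_iff.mp (by simp [Matrix.trace, h]))
  obtain ⟨i, hi, hmin⟩ := (Finset.univ.filter fun i => A i i ≠ 0).exists_min_image id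
    ⟨hex.choose, by simpa using hex.choose_spec⟩
  refine ⟨i, fun j hj => ?_, by simpa using hi⟩
  by_contra h
  exact absurd (hmin j (by simpa using h)) (not_le.mpr hj)

/-- The data of the first pivot: `z = A e / √a` with `a = ⟨e, A e⟩ > 0`. -/
theorem exists_pivotCol_eq {A : Matrix (Fin n) (Fin n) ℂ} (hA : A.PosSemidef) (h0 : A ≠ 0) :
    ∃ (i : Fin n) (s : ℝ), 0 < s ∧ A i i = ((s ^ 2 : ℝ) : ℂ) ∧
      pivotCol A = ((s : ℂ)⁻¹) • A *ᵥ Pi.single i 1 := by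
  classical
  obtain ⟨i, hi, hi'⟩ := exists_pivot hA h0
  have h1 : 0 ≤ A i i := hA.diag_nonneg
  obtain ⟨h2, h3⟩ := Complex.le_def.mp h1
  have h4 : A i i = ((A i i).re : ℂ) := Complex.ext rfl (by simpa using h3.symm)
  have h5 : 0 < (A i i).re := lt_of_le_of_ne h2 fun h => hi' (by rw [h4, ← h]; simp)
  refine ⟨i, Real.sqrt (A i i).re, Real.sqrt_pos.mpr h5, ?_, ?_⟩
  · rw [Real.sq_sqrt h5.le]; exact h4
  · rw [pivotCol_eq hi hi', mulVec_single_one]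

theorem star_pivotCol_dotProduct {A : Matrix (Fin n) (Fin n) ℂ} (hA : A.PosSemidef) {i : Fin n}
    {s : ℝ} (hz : pivotCol A = ((s : ℂ)⁻¹) • A *ᵥ Pi.single i 1) (v : Fin n → ℂ) :
    star (pivotCol A) ⬝ᵥ v = (s : ℂ)⁻¹ * (A *ᵥ v) i := by
  classical
  rw [hz, star_smul, star_mulVec, hA.1.eq, smul_dotProduct, ← dotProduct_mulVec]
  simp [Pi.star_single]

theorem pivotRem_mulVec (A : Matrix (Fin n) (Fin n) ℂ) (v : Fin n → ℂ) :
    pivotRem A *ᵥ v = A *ᵥ v - (star (pivotCol A) ⬝ᵥ v) • pivotCol A := by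
  rw [pivotRem, sub_mulVec, vecMulVec_mulVec]
  simp

theorem posSemidef_pivotRem {A : Matrix (Fin n) (Fin n) ℂ} (hA : A.PosSemidef) :
    (pivotRem A).PosSemidef := by
  classical
  by_cases h0 : A = 0
  · rw [h0, pivotRem_zero]; exact PosSemidef.zero
  obtain ⟨i, s, hs, hi, hz⟩ := exists_pivotCol_eq hA h0
  refine PosSemidef.of_dotProduct_mulVec_nonneg ?_ fun v => ?_
  · refine hA.1.sub ?_
    rw [IsHermitian, conjTranspose_vecMulVec, star_star]
  -- completing the square: subtract the component along the pivot
  set t : ℂ := (s : ℂ)⁻¹ * (s : ℂ)⁻¹ * (A *ᵥ v) i with ht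
  have hs' : (s : ℂ) ≠ 0 := by exact_mod_cast hs.ne'
  have key := hA.dotProduct_mulVec_nonneg (v - t • Pi.single i 1)
  have e1 : star (Pi.single i (1 : ℂ) : Fin n → ℂ) ⬝ᵥ (A *ᵥ v) = (A *ᵥ v) i := by
    simp [Pi.star_single]
  have e2 : star v ⬝ᵥ (A *ᵥ Pi.single i 1) = star ((A *ᵥ v) i) := by
    rw [← e1, star_dotProduct, star_mulVec, hA.1.eq, ← dotProduct_mulVec]
  have e3 : star (Pi.single i (1 : ℂ) : Fin n → ℂ) ⬝ᵥ (A *ᵥ Pi.single i 1) = (s : ℂ) ^ 2 := by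
    rw [← Complex.ofReal_pow, ← hi]
    simp [Pi.star_single]
  have e4 : star v ⬝ᵥ pivotCol A = (s : ℂ)⁻¹ * star ((A *ᵥ v) i) := by
    rw [hz, dotProduct_smul, e2, smul_eq_mul]
  rw [pivotRem_mulVec, dotProduct_sub, dotProduct_smul, star_pivotCol_dotProduct hA hz, e4]
  rw [star_sub, star_smul, mulVec_sub, mulVec_smul, sub_dotProduct, dotProduct_sub, dotProduct_sub,
    smul_dotProduct, smul_dotProduct, dotProduct_smul, dotProduct_smul, e1, e2, e3] at key
  convert key using 1
  have : star t = (s : ℂ)⁻¹ * (s : ℂ)⁻¹ * star ((A *ᵥ v) i) := by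
    simp [ht]
  rw [this, ht]
  simp only [smul_eq_mul]
  field_simp
  ring

/-- The kernel strictly grows: the kernel of `A` is retained, and the pivot basis vector, on which
`A` is nonzero, is added. -/
theorem rank_pivotRem_lt {A : Matrix (Fin n) (Fin n) ℂ} (hA : A.PosSemidef) (h0 : A ≠ 0) :
    (pivotRem A).rank < A.rank := by
  classical
  obtain ⟨i, s, hs, hi, hz⟩ := exists_pivotCol_eq hA h0
  have hs' : (s : ℂ) ≠ 0 := by exact_mod_cast hs.ne'
  have hlt : A.mulVecLin.ker < (pivotRem A).mulVecLin.ker := by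
    refine lt_of_le_of_ne (fun v hv => ?_) fun h => ?_
    · simp only [LinearMap.mem_ker, mulVecLin_apply] at hv ⊢
      rw [pivotRem_mulVec, star_pivotCol_dotProduct hA hz, hv]
      simp
    · have h1 : (Pi.single i 1 : Fin n → ℂ) ∈ (pivotRem A).mulVecLin.ker := by
        rw [LinearMap.mem_ker, mulVecLin_apply, pivotRem_mulVec, star_pivotCol_dotProduct hA hz, hz,
          smul_smul]
        have : (A *ᵥ Pi.single i 1) i = (s : ℂ) ^ 2 := by
          rw [← Complex.ofReal_pow, ← hi]; simp
        rw [this]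
        field_simp
        simp
      rw [← h, LinearMap.mem_ker, mulVecLin_apply] at h1
      have h2 := congrFun h1 i
      simp only [mulVec_single_one, col_apply, Pi.zero_apply] at h2
      rw [hi] at h2
      exact hs.ne' (by simpa using h2)
  have h1 := Submodule.finrank_lt_finrank_of_lt hlt
  have h2 := A.mulVecLin.finrank_range_add_finrank_ker
  have h3 := (pivotRem A).mulVecLin.finrank_range_add_finrank_ker
  simp only [Matrix.rank]
  omega

theorem matrix_rank_add_le (A B : Matrix (Fin n) (Fin n) ℂ) : (A + B).rank ≤ A.rank + B.rank := by
  simp only [Matrix.rank]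
  refine (Submodule.finrank_mono ?_).trans
    (Submodule.finrank_add_le_finrank_add_finrank A.mulVecLin.range B.mulVecLin.range)
  rintro _ ⟨v, rfl⟩
  rw [mulVecLin_add]
  exact Submodule.add_mem_sup (LinearMap.mem_range_self _ v) (LinearMap.mem_range_self _ v)

theorem rank_le_rank_pivotRem_add_one (A : Matrix (Fin n) (Fin n) ℂ) :
    A.rank ≤ (pivotRem A).rank + 1 := by
  have h : A = pivotRem A + vecMulVec (pivotCol A) (star (pivotCol A)) := by simp [pivotRem]
  conv_lhs => rw [h]
  exact (matrix_rank_add_le _ _).trans (by gcongr; exact rank_vecMulVec_le _ _)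

/-- For a nonzero orthogonal projection the first pivot is a unit vector in its range. -/
theorem pivotCol_of_isIdempotentElem {Q : Matrix (Fin n) (Fin n) ℂ} (hQ : Q.PosSemidef)
    (hQQ : Q * Q = Q) (h0 : Q ≠ 0) :
    star (pivotCol Q) ⬝ᵥ pivotCol Q = 1 ∧ Q *ᵥ pivotCol Q = pivotCol Q := by
  classical
  obtain ⟨i, s, hs, hi, hz⟩ := exists_pivotCol_eq hQ h0
  have hs' : (s : ℂ) ≠ 0 := by exact_mod_cast hs.ne'
  have h2 : Q *ᵥ pivotCol Q = pivotCol Q := by rw [hz, mulVec_smul, mulVec_mulVec, hQQ]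
  refine ⟨?_, h2⟩
  rw [star_pivotCol_dotProduct hQ hz, h2, hz]
  simp only [mulVec_single_one, Pi.smul_apply, col_apply, hi, smul_eq_mul]
  push_cast
  field_simp

/-- Removing `u u*` from an orthogonal projection, with `u` a unit vector of its range, leaves an
orthogonal projection. Hence the successive pivots of `Q` are orthonormal vectors in its range. -/
theorem isIdempotentElem_pivotRem {Q : Matrix (Fin n) (Fin n) ℂ} (hQ : Q.PosSemidef)
    (hQQ : Q * Q = Q) : pivotRem Q * pivotRem Q = pivotRem Q := by
  by_cases h0 : Q = 0
  · simp [h0, pivotRem_zero]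
  obtain ⟨h1, h2⟩ := pivotCol_of_isIdempotentElem hQ hQQ h0
  have h3 : star (pivotCol Q) ᵥ* Q = star (pivotCol Q) := by
    conv_rhs => rw [← h2, star_mulVec, hQ.1.eq]
  rw [pivotRem, mul_sub, sub_mul, sub_mul, hQQ, mul_vecMulVec, h2, vecMulVec_mul, h3,
    vecMulVec_mul_vecMulVec, h1]
  simp

/-- If `A` is positive semidefinite, `Q` is an orthogonal projection, and `rank A ≤ rank Q`, then
`C = pivotFactor m A Q` satisfies `C C* = A` and `C Q = C`. -/
theorem pivotFactor_spec (m : ℕ) : ∀ {A Q : Matrix (Fin n) (Fin n) ℂ}, A.PosSemidef →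
    Q.PosSemidef → Q * Q = Q → A.rank ≤ m → A.rank ≤ Q.rank →
    pivotFactor m A Q * (pivotFactor m A Q)ᴴ = A ∧ pivotFactor m A Q * Q = pivotFactor m A Q := by
  induction m with
  | zero =>
    intro A Q hA hQ hQQ hm hr
    have : A = 0 := by
      by_contra h
      exact absurd (rank_pivotRem_lt hA h) (by omega)
    simp [pivotFactor, this]
  | succ m ih =>
    intro A Q hA hQ hQQ hm hr
    have hA' := posSemidef_pivotRem hA
    have hQ' := posSemidef_pivotRem hQ
    have hQQ' := isIdempotentElem_pivotRem hQ hQQ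
    -- `A` may be exhausted before the steps are. The remaining factor then satisfies `C C* = 0`, so
    -- it vanishes, whatever is left of `Q`.
    by_cases h0 : A = 0
    · obtain ⟨h1, h2⟩ := ih (A := 0) PosSemidef.zero hQ' hQQ' (by simp) (by simp)
      have h3 : pivotFactor m 0 (pivotRem Q) = 0 := by
        simpa using h1
      have h4 : vecMulVec (0 : Fin n → ℂ) (star (pivotCol Q)) = 0 := by ext; simp [vecMulVec]
      simp [h0, pivotFactor, pivotRem_zero, pivotCol_zero, h3, h4]
    have hlt := rank_pivotRem_lt hA h0
    have hQ0 : Q ≠ 0 := by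
      rintro rfl
      rw [Matrix.rank_zero] at hr
      omega
    have hQr := rank_le_rank_pivotRem_add_one Q
    obtain ⟨h1, h2⟩ := ih hA' hQ' hQQ' (by omega) (by omega)
    obtain ⟨h3, h4⟩ := pivotCol_of_isIdempotentElem hQ hQQ hQ0
    set C := pivotFactor m (pivotRem A) (pivotRem Q) with hC
    set z := pivotCol A
    set u := pivotCol Q with hu
    -- `C` factors through `pivotRem Q`, which kills `u`. This removes the cross terms in `(z u* +
    -- C)(z u* + C)*`.
    have h5 : C *ᵥ u = 0 := by
      rw [← h2, ← mulVec_mulVec, pivotRem_mulVec, h4, ← hu, h3]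
      simp
    have h6 : star u ᵥ* Cᴴ = 0 := by rw [← star_mulVec, h5, star_zero]
    have h7 : star u ᵥ* Q = star u := by
      conv_rhs => rw [← h4, star_mulVec, hQ.1.eq]
    have e : pivotFactor (m + 1) A Q = vecMulVec z (star u) + C := rfl
    rw [e]
    constructor
    · rw [conjTranspose_add, conjTranspose_vecMulVec, star_star, add_mul, mul_add, mul_add, h1,
        vecMulVec_mul_vecMulVec, h3, vecMulVec_mul, h6, mul_vecMulVec, h5]
      have h8 : vecMulVec z (0 : Fin n → ℂ) = 0 := by ext; simp [vecMulVec]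
      have h9 : vecMulVec (0 : Fin n → ℂ) (star z) = 0 := by ext; simp [vecMulVec]
      rw [h8, h9, pivotRem]
      simp [z]
    · have h8 : C * Q = C := by
        conv_lhs => rw [← h2]
        have : pivotRem Q * Q = pivotRem Q := by
          rw [pivotRem, sub_mul, hQQ, vecMulVec_mul, h7]
        rw [mul_assoc, this, h2]
      rw [add_mul, vecMulVec_mul, h7, h8]

theorem measurable_pivotCol {X : Type*} [MeasurableSpace X] {A : X → Matrix (Fin n) (Fin n) ℂ}
    (hA : ∀ i j, Measurable fun x => A x i j) (i : Fin n) :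
    Measurable fun x => pivotCol (A x) i := by
  classical
  simp only [pivotCol, Finset.sum_apply]
  refine Finset.measurable_sum _ fun j _ => ?_
  have hs : MeasurableSet {x | (∀ l < j, A x l l = 0) ∧ A x j j ≠ 0} := by
    refine MeasurableSet.inter ?_ ?_
    · have : {x | ∀ l < j, A x l l = 0} = ⋂ l, ⋂ _ : l < j, {x | A x l l = 0} := by
        ext; simp
      change MeasurableSet {x | ∀ l < j, A x l l = 0}
      rw [this]
      exact MeasurableSet.iInter fun l => MeasurableSet.iInter fun _ =>
        measurableSet_eq_fun (hA l l) measurable_const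
    · exact (measurableSet_eq_fun (hA j j) measurable_const).compl
  have h1 : Measurable fun x => ((Real.sqrt (A x j j).re : ℂ)⁻¹) * A x i j :=
    (Complex.measurable_ofReal.comp (Complex.measurable_re.comp (hA j j)).sqrt).inv.mul (hA i j)
  have h3 : (fun x => (if (∀ l < j, A x l l = 0) ∧ A x j j ≠ 0 then
      ((Real.sqrt (A x j j).re : ℂ)⁻¹) • (A x).col j else 0) i) =
      fun x => if (∀ l < j, A x l l = 0) ∧ A x j j ≠ 0 then
        ((Real.sqrt (A x j j).re : ℂ)⁻¹) * A x i j else 0 := by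
    ext x
    split_ifs <;> simp
  rw [h3]
  exact Measurable.ite hs h1 measurable_const

theorem measurable_pivotFactor {X : Type*} [MeasurableSpace X] (m : ℕ) :
    ∀ {A Q : X → Matrix (Fin n) (Fin n) ℂ}, (∀ i j, Measurable fun x => A x i j) →
      (∀ i j, Measurable fun x => Q x i j) →
      ∀ i j, Measurable fun x => pivotFactor m (A x) (Q x) i j := by
  induction m with
  | zero => intro A Q _ _ i j; simp [pivotFactor]
  | succ m ih =>
    intro A Q hA hQ i j
    have hrem : ∀ {A : X → Matrix (Fin n) (Fin n) ℂ}, (∀ i j, Measurable fun x => A x i j) →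
        ∀ i j, Measurable fun x => pivotRem (A x) i j := by
      intro A hA i j
      simp only [pivotRem, Matrix.sub_apply, vecMulVec_apply, Pi.star_apply]
      exact (hA i j).sub ((measurable_pivotCol hA i).mul (continuous_star.measurable.comp (measurable_pivotCol hA j)))
    simp only [pivotFactor, Matrix.add_apply, vecMulVec_apply, Pi.star_apply]
    exact ((measurable_pivotCol hA i).mul (continuous_star.measurable.comp (measurable_pivotCol hQ j))).add
      (ih (hrem hA) (hrem hQ) i j)

end PivotedFactorization

/-! ### Lattice translations and the fundamental cube -/

section Fibers

variable {k n : ℕ}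

/-! ### Translations -/

/-- The character `x ↦ exp (-2πi ⟨ℓ, x⟩)`. -/
noncomputable def latticeChar (ℓ : Fin k → ℤ) (x : EuclideanSpace ℝ (Fin k)) : ℂ :=
  (Real.fourierChar (-⟪latticePt ℓ, x⟫_ℝ) : ℂ)

theorem norm_latticeChar (ℓ : Fin k → ℤ) (x : EuclideanSpace ℝ (Fin k)) :
    ‖latticeChar ℓ x‖ = 1 := Circle.norm_coe _

theorem continuous_latticeChar (ℓ : Fin k → ℤ) : Continuous (latticeChar ℓ) := by
  unfold latticeChar
  fun_prop

theorem latticePt_add (ℓ m : Fin k → ℤ) : latticePt (ℓ + m) = latticePt ℓ + latticePt m := by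
  ext j; simp [latticePt]

theorem latticePt_zero : latticePt (0 : Fin k → ℤ) = 0 := by
  ext j; simp [latticePt]

theorem latticePt_apply (ℓ : Fin k → ℤ) (j : Fin k) : latticePt ℓ j = ℓ j := rfl

theorem inner_latticePt (ℓ m : Fin k → ℤ) : ⟪latticePt ℓ, latticePt m⟫_ℝ = (∑ j, ℓ j * m j : ℤ) := by
  simp [PiLp.inner_apply, latticePt, mul_comm]

theorem latticeChar_add_latticePt (ℓ m : Fin k → ℤ) (x : EuclideanSpace ℝ (Fin k)) :
    latticeChar ℓ (x + latticePt m) = latticeChar ℓ x := by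
  rw [latticeChar, latticeChar, inner_add_right, inner_latticePt, neg_add, AddChar.map_add_eq_mul]
  have : Real.fourierChar (-((∑ j, ℓ j * m j : ℤ) : ℝ)) = 1 := by
    ext
    rw [Real.fourierChar_apply]
    simp only [Circle.coe_one]
    rw [Complex.exp_eq_one_iff]
    refine ⟨-(∑ j, ℓ j * m j), ?_⟩
    push_cast
    ring
  rw [this, mul_one]

theorem coeFn_shiftBy (ℓ : Fin k → ℤ) (f : L2R k) :
    shiftBy ℓ f =ᵐ[volume] fun x => f (x - latticePt ℓ) :=
  Lp.coeFn_compMeasurePreserving _ _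

theorem shiftBy_shiftBy (ℓ m : Fin k → ℤ) (f : L2R k) :
    shiftBy ℓ (shiftBy m f) = shiftBy (ℓ + m) f := by
  refine Lp.ext ?_
  have h1 := (measurePreserving_sub_right volume (latticePt ℓ)).quasiMeasurePreserving.ae
    (coeFn_shiftBy m f)
  filter_upwards [coeFn_shiftBy ℓ (shiftBy m f), coeFn_shiftBy (ℓ + m) f, h1] with x e1 e2 e3
  rw [e1, e2, e3, latticePt_add, sub_sub]

theorem shiftBy_zero (f : L2R k) : shiftBy 0 f = f := by
  refine Lp.ext ?_
  filter_upwards [coeFn_shiftBy 0 f] with x e1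
  rw [e1, latticePt_zero, sub_zero]

/-- Translation by a lattice point as a unitary operator. -/
noncomputable def shiftEquiv (ℓ : Fin k → ℤ) : L2R k ≃ₗᵢ[ℂ] L2R k where
  toLinearMap := (Lp.compMeasurePreservingₗᵢ ℂ _
    (measurePreserving_sub_right volume (latticePt ℓ))).toLinearMap
  invFun := shiftBy (-ℓ)
  left_inv f := by
    change shiftBy (-ℓ) (shiftBy ℓ f) = f
    rw [shiftBy_shiftBy, neg_add_cancel, shiftBy_zero]
  right_inv f := by
    change shiftBy ℓ (shiftBy (-ℓ) f) = f
    rw [shiftBy_shiftBy, add_neg_cancel, shiftBy_zero]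
  norm_map' f := (Lp.compMeasurePreservingₗᵢ ℂ _
    (measurePreserving_sub_right volume (latticePt ℓ))).norm_map f

theorem shiftEquiv_apply (ℓ : Fin k → ℤ) (f : L2R k) : shiftEquiv ℓ f = shiftBy ℓ f := rfl

theorem shiftEquiv_symm_apply (ℓ : Fin k → ℤ) (f : L2R k) :
    (shiftEquiv ℓ).symm f = shiftBy (-ℓ) f := rfl

theorem shiftBy_add (ℓ : Fin k → ℤ) (f g : L2R k) :
    shiftBy ℓ (f + g) = shiftBy ℓ f + shiftBy ℓ g := (shiftEquiv ℓ).map_add f g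

theorem shiftBy_sub (ℓ : Fin k → ℤ) (f g : L2R k) :
    shiftBy ℓ (f - g) = shiftBy ℓ f - shiftBy ℓ g := (shiftEquiv ℓ).map_sub f g

theorem inner_shiftBy (ℓ : Fin k → ℤ) (f g : L2R k) :
    ⟪shiftBy ℓ f, g⟫_ℂ = ⟪f, shiftBy (-ℓ) g⟫_ℂ := by
  rw [← shiftEquiv_symm_apply, ← shiftEquiv_apply, ← (shiftEquiv ℓ).inner_map_map f,
    (shiftEquiv ℓ).apply_symm_apply]

/-- Multiplication by a lattice character preserves `L²`. -/
theorem memLp_latticeChar_mul (ℓ : Fin k → ℤ) {F : EuclideanSpace ℝ (Fin k) → ℂ}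
    (hF : MemLp F 2 volume) : MemLp (fun x => latticeChar ℓ x * F x) 2 volume :=
  (memLp_congr_norm ((continuous_latticeChar ℓ).aestronglyMeasurable.mul hF.1) hF.1
    (Filter.Eventually.of_forall fun x => by simp [norm_latticeChar])).mpr hF

theorem continuous_latticeChar_mul (ℓ : Fin k → ℤ) :
    Continuous fun f : L2R k => (memLp_latticeChar_mul ℓ (Lp.memLp f)).toLp _ := by
  refine Isometry.continuous (Isometry.of_dist_eq fun f g => ?_)
  rw [dist_eq_norm, dist_eq_norm, ← MemLp.toLp_sub, Lp.norm_toLp, Lp.norm_def]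
  congr 1
  refine eLpNorm_congr_norm_ae ?_
  filter_upwards [Lp.coeFn_sub f g] with x hx
  rw [hx, Pi.sub_apply, Pi.sub_apply, ← mul_sub, norm_mul, norm_latticeChar, one_mul]

theorem fourier_shiftBy_schwartz (ℓ : Fin k → ℤ)
    (φ : SchwartzMap (EuclideanSpace ℝ (Fin k)) ℂ) :
    (𝓕 (shiftBy ℓ (φ.toLp 2)) : L2R k) =
      (memLp_latticeChar_mul ℓ (Lp.memLp (𝓕 (φ.toLp 2) : L2R k))).toLp _ := by
  have h1 : shiftBy ℓ (φ.toLp 2) = (φ.compSubConstCLM ℂ (latticePt ℓ)).toLp 2 := rfl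
  rw [h1, SchwartzMap.toLp_fourier_eq]
  refine Lp.ext ?_
  refine (SchwartzMap.coeFn_toLp _ _ _).trans (Filter.EventuallyEq.trans ?_
    (MemLp.coeFn_toLp _).symm)
  rw [SchwartzMap.toLp_fourier_eq]
  filter_upwards [SchwartzMap.coeFn_toLp (𝓕 φ) 2 volume] with x hx
  rw [hx, SchwartzMap.fourier_coe, SchwartzMap.fourier_coe]
  have h2 : ((φ.compSubConstCLM ℂ (latticePt ℓ) : SchwartzMap _ ℂ) :
      EuclideanSpace ℝ (Fin k) → ℂ) = φ ∘ fun v => v + (-latticePt ℓ) := by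
    ext v; simp [sub_eq_add_neg]
  rw [h2]
  have h3 := congrFun (VectorFourier.fourierIntegral_comp_add_right Real.fourierChar volume
    (innerₗ (EuclideanSpace ℝ (Fin k))) φ (-latticePt ℓ)) x
  refine h3.trans ?_
  rw [map_neg, LinearMap.neg_apply, innerₗ_apply_apply]
  rfl

/-- For Schwartz functions this is the translation rule for the Fourier integral; both sides are
continuous in `f`, and Schwartz functions are dense. -/
theorem fourier_shiftBy (ℓ : Fin k → ℤ) (f : L2R k) :
    (𝓕 (shiftBy ℓ f) : L2R k) =ᵐ[volume] fun x => latticeChar ℓ x * (𝓕 f : L2R k) x := by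
  have h : (𝓕 (shiftBy ℓ f) : L2R k) =
      (memLp_latticeChar_mul ℓ (Lp.memLp (𝓕 f : L2R k))).toLp _ := by
    refine DenseRange.induction_on (SchwartzMap.denseRange_toLpCLM (p := 2) ENNReal.ofNat_ne_top)
      (p := fun f : L2R k => (𝓕 (shiftBy ℓ f) : L2R k) =
        (memLp_latticeChar_mul ℓ (Lp.memLp (𝓕 f : L2R k))).toLp _) f ?_
        (fun φ => fourier_shiftBy_schwartz ℓ φ)
    refine isClosed_eq ?_ ?_
    · exact (Lp.fourierTransformₗᵢ _ _).continuous.comp (shiftEquiv ℓ).continuous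
    · exact (continuous_latticeChar_mul ℓ).comp (Lp.fourierTransformₗᵢ _ _).continuous
  rw [h]
  exact MemLp.coeFn_toLp _

/-! ### The torus tiles the space -/

/-- The lattice point `ℓ` with `x - ℓ` in the torus. -/
noncomputable def latticeRound (x : EuclideanSpace ℝ (Fin k)) : Fin k → ℤ :=
  fun j => ⌊x j + 1 / 2⌋

theorem measurable_latticeRound : Measurable (latticeRound (k := k)) :=
  measurable_pi_lambda _ fun j => Int.measurable_floor.comp (by fun_prop)

theorem sub_latticePt_mem_torus_iff (x : EuclideanSpace ℝ (Fin k)) (ℓ : Fin k → ℤ) :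
    x - latticePt ℓ ∈ torus k ↔ latticeRound x = ℓ := by
  simp only [torus, Set.mem_ofPred_eq, Set.mem_Ico, PiLp.sub_apply, latticePt_apply, funext_iff,
    latticeRound, Int.floor_eq_iff]
  refine forall_congr' fun j => ⟨fun h => ⟨by linarith [h.1], by linarith [h.2]⟩,
    fun h => ⟨by linarith [h.1], by linarith [h.2]⟩⟩

theorem latticeRound_add {x : EuclideanSpace ℝ (Fin k)} (hx : x ∈ torus k) (ℓ : Fin k → ℤ) :
    latticeRound (x + latticePt ℓ) = ℓ := by
  rw [← sub_latticePt_mem_torus_iff, add_sub_cancel_right]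
  exact hx

theorem measurableSet_torus : MeasurableSet (torus k) := by
  have : torus k = ⋂ j, (fun x : EuclideanSpace ℝ (Fin k) => x j) ⁻¹' Set.Ico (-(1 / 2)) (1 / 2) := by
    ext; simp [torus]
  rw [this]
  exact MeasurableSet.iInter fun j => (by fun_prop : Measurable fun x :
    EuclideanSpace ℝ (Fin k) => x j) measurableSet_Ico

/-- The level sets of `latticeRound` partition the space and are the lattice translates of the cube;
translation invariance moves each back to the cube. -/
theorem lintegral_eq_lintegral_torus_tsum {F : EuclideanSpace ℝ (Fin k) → ℝ≥0∞}
    (hF : Measurable F) :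
    ∫⁻ x, F x = ∫⁻ x, ∑' ℓ : Fin k → ℤ, F (x + latticePt ℓ) ∂torusMeasure k := by
  rw [lintegral_tsum (f := fun (ℓ : Fin k → ℤ) x => F (x + latticePt ℓ))
    fun ℓ => (hF.comp (measurable_add_const _)).aemeasurable]
  have hU : (⋃ ℓ : Fin k → ℤ, latticeRound (k := k) ⁻¹' {ℓ}) = Set.univ := by ext; simp
  rw [← setLIntegral_univ, ← hU, lintegral_iUnion
    (fun ℓ => measurable_latticeRound (measurableSet_singleton ℓ))
    (fun i j hij => Set.disjoint_left.mpr fun x hi hj => hij (hi.symm.trans hj))]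
  congr 1
  ext ℓ
  have h1 : (fun x => x + latticePt ℓ) ⁻¹' (latticeRound (k := k) ⁻¹' {ℓ}) = torus k := by
    ext x
    simp only [Set.mem_preimage, Set.mem_singleton_iff]
    rw [← sub_latticePt_mem_torus_iff, add_sub_cancel_right]
  rw [torusMeasure, ← h1]
  exact ((measurePreserving_add_right volume (latticePt ℓ)).setLIntegral_comp_preimage_emb
    (measurableEmbedding_addRight _) _ _).symm

theorem ae_torus_of_ae {p : EuclideanSpace ℝ (Fin k) → Prop} (hp : ∀ᵐ x, p x) :
    ∀ᵐ x ∂torusMeasure k, ∀ ℓ : Fin k → ℤ, p (x + latticePt ℓ) :=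
  ae_restrict_of_ae (ae_all_iff.mpr fun ℓ =>
    (measurePreserving_add_right volume (latticePt ℓ)).quasiMeasurePreserving.ae hp)

end Fibers

/-! ### Fiberization as an isometric isomorphism onto the square-integrable fields -/

section FiberIsometry

variable {k n : ℕ}

theorem enorm_sq_ell2 {ι : Type} (v : Ell2 ι) : ‖v‖ₑ ^ 2 = ∑' i, ‖v i‖ₑ ^ 2 := by
  have h1 := lp.hasSum_norm (p := 2) (by norm_num) v
  simp only [ENNReal.toReal_ofNat, Real.rpow_ofNat] at h1
  have h2 := ENNReal.ofReal_tsum_of_nonneg (fun i => by positivity) h1.summable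
  rw [h1.tsum_eq] at h2
  simp only [ENNReal.ofReal_pow (norm_nonneg _), ofReal_norm] at h2
  exact h2

theorem memℓp_two_iff_tsum {ι : Type} (a : ι → ℂ) : Memℓp a 2 ↔ ∑' i, ‖a i‖ₑ ^ 2 ≠ ∞ := by
  rw [memℓp_gen_iff (by norm_num)]
  simp only [ENNReal.toReal_ofNat, Real.rpow_ofNat]
  have h : ∀ i, ‖a i‖ₑ ^ 2 = ((‖a i‖₊ ^ 2 : NNReal) : ℝ≥0∞) := fun i => by simp [enorm]
  simp only [h]
  rw [ENNReal.tsum_coe_ne_top_iff_summable, ← NNReal.summable_coe]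
  simp

theorem lintegral_enorm_sq_ne_top {α G : Type*} [MeasurableSpace α] {μ : Measure α}
    [NormedAddCommGroup G] {f : α → G} (hf : MemLp f 2 μ) : ∫⁻ x, ‖f x‖ₑ ^ 2 ∂μ ≠ ∞ := by
  have := (eLpNorm_lt_top_iff_lintegral_rpow_enorm_lt_top (by norm_num) (by norm_num)).mp hf.2
  simpa using this.ne

theorem memLp_two_of_lintegral {α G : Type*} [MeasurableSpace α] {μ : Measure α}
    [NormedAddCommGroup G] {f : α → G} (hf : AEStronglyMeasurable f μ)
    (h : ∫⁻ x, ‖f x‖ₑ ^ 2 ∂μ ≠ ∞) : MemLp f 2 μ := by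
  refine ⟨hf, (eLpNorm_lt_top_iff_lintegral_rpow_enorm_lt_top (by norm_num) (by norm_num)).mpr ?_⟩
  simpa using h.lt_top

/-- The integral over the cube of `∑ |f̂(x + ℓ)|²` is finite, so the sum is finite almost everywhere
and the default value in `fiberization` matters only on a null set. -/
theorem fiberization_apply (f : L2R k) :
    ∀ᵐ x ∂torusMeasure k, ∀ ℓ : Fin k → ℤ,
      fiberization f x ℓ = (𝓕 f : L2R k) (x + latticePt ℓ) := by
  have hm : Measurable fun x => ‖(𝓕 f : L2R k) x‖ₑ ^ 2 :=
    (Lp.stronglyMeasurable (𝓕 f : L2R k)).enorm.pow_const 2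
  have h1 := lintegral_enorm_sq_ne_top (Lp.memLp (𝓕 f : L2R k))
  rw [lintegral_eq_lintegral_torus_tsum hm] at h1
  have h2 := ae_lt_top' (Measurable.tsum fun ℓ =>
    hm.comp (measurable_add_const (latticePt ℓ))).aemeasurable h1
  filter_upwards [h2] with x hx ℓ
  have h3 := (memℓp_two_iff_tsum fun ℓ : Fin k → ℤ => (𝓕 f : L2R k) (x + latticePt ℓ)).mpr hx.ne
  rw [fiberization, dif_pos h3]

/-- Fields of vectors in `ℓ²` are measurable if their coordinates are. -/
theorem aestronglyMeasurable_of_coord {α ι : Type} [Countable ι] [MeasurableSpace α]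
    {μ : Measure α} {z : α → Ell2 ι} (hz : ∀ i, AEStronglyMeasurable (fun x => z x i) μ) :
    AEStronglyMeasurable z μ := by
  classical
  refine aestronglyMeasurable_of_tendsto_ae (Filter.atTop : Filter (Finset ι))
    (f := fun s x => ∑ i ∈ s, z x i • (lp.single 2 i (1 : ℂ) : Ell2 ι)) (fun s => ?_) ?_
  · exact Finset.aestronglyMeasurable_fun_sum _ fun i _ => (hz i).smul_const _
  · refine Filter.Eventually.of_forall fun x => ?_
    have h := lp.hasSum_single (p := 2) (by norm_num) (z x)
    have e : ∀ i, z x i • (lp.single 2 i (1 : ℂ) : Ell2 ι) = lp.single 2 i (z x i) := fun i => by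
      have := lp.single_smul (E := fun _ : ι => ℂ) (p := 2) i (z x i) (1 : ℂ)
      rw [← this, smul_eq_mul, mul_one]
    simp only [e]
    exact h

theorem aestronglyMeasurable_fiberization (f : L2R k) :
    AEStronglyMeasurable (fiberization f) (torusMeasure k) := by
  refine aestronglyMeasurable_of_coord fun ℓ => ?_
  have h : StronglyMeasurable fun x => (𝓕 f : L2R k) (x + latticePt ℓ) :=
    (Lp.stronglyMeasurable (𝓕 f : L2R k)).comp_measurable (measurable_add_const _)
  refine h.aestronglyMeasurable.congr ?_
  filter_upwards [fiberization_apply f] with x hx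
  exact (hx ℓ).symm

theorem lintegral_fiberization (f : L2R k) :
    ∫⁻ x, ‖fiberization f x‖ₑ ^ 2 ∂torusMeasure k = ∫⁻ x, ‖(𝓕 f : L2R k) x‖ₑ ^ 2 := by
  rw [lintegral_eq_lintegral_torus_tsum
    ((Lp.stronglyMeasurable (𝓕 f : L2R k)).enorm.pow_const 2)]
  refine lintegral_congr_ae ?_
  filter_upwards [fiberization_apply f] with x hx
  rw [enorm_sq_ell2]
  simp only [hx]

theorem memLp_fiberization (f : L2R k) : MemLp (fiberization f) 2 (torusMeasure k) :=
  memLp_two_of_lintegral (aestronglyMeasurable_fiberization f)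
    (by rw [lintegral_fiberization]; exact lintegral_enorm_sq_ne_top (Lp.memLp _))

theorem fiberization_add (f g : L2R k) :
    ∀ᵐ x ∂torusMeasure k, fiberization (f + g) x = fiberization f x + fiberization g x := by
  have h := ae_torus_of_ae (Lp.coeFn_add (𝓕 f : L2R k) (𝓕 g))
  filter_upwards [fiberization_apply f, fiberization_apply g, fiberization_apply (f + g), h]
    with x h1 h2 h3 h4
  ext ℓ
  rw [h3, FourierTransform.fourier_add, h4, lp.coeFn_add, Pi.add_apply, Pi.add_apply, h1, h2]

theorem fiberization_smul (c : ℂ) (f : L2R k) :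
    ∀ᵐ x ∂torusMeasure k, fiberization (c • f) x = c • fiberization f x := by
  have h := ae_torus_of_ae (Lp.coeFn_smul c (𝓕 f : L2R k))
  filter_upwards [fiberization_apply f, fiberization_apply (c • f), h] with x h1 h3 h4
  ext ℓ
  rw [h3, FourierTransform.fourier_smul, h4, lp.coeFn_smul, Pi.smul_apply, Pi.smul_apply, h1]

theorem fiberization_shiftBy (ℓ : Fin k → ℤ) (f : L2R k) :
    ∀ᵐ x ∂torusMeasure k, fiberization (shiftBy ℓ f) x = latticeChar ℓ x • fiberization f x := by
  have h := ae_torus_of_ae (fourier_shiftBy ℓ f)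
  filter_upwards [fiberization_apply f, fiberization_apply (shiftBy ℓ f), h] with x h1 h3 h4
  ext m
  rw [h3, h4, lp.coeFn_smul, Pi.smul_apply, h1, latticeChar_add_latticePt, smul_eq_mul]

/-- Fiberization as a linear isometry into `L²(𝕋ᵏ; ℓ²(ℤᵏ))`. -/
noncomputable def fiberIsometry (k : ℕ) :
    L2R k →ₗᵢ[ℂ] Lp (Ell2 (Fin k → ℤ)) 2 (torusMeasure k) where
  toFun f := (memLp_fiberization f).toLp _
  map_add' f g := by
    rw [← MemLp.toLp_add, MemLp.toLp_eq_toLp_iff]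
    exact fiberization_add f g
  map_smul' c f := by
    rw [RingHom.id_apply, ← MemLp.toLp_const_smul, MemLp.toLp_eq_toLp_iff]
    exact fiberization_smul c f
  norm_map' f := by
    rw [← Lp.norm_fourier_eq f]
    change ‖(memLp_fiberization f).toLp _‖ = _
    rw [Lp.norm_toLp, Lp.norm_def, eLpNorm_eq_lintegral_rpow_enorm_toReal (by norm_num) (by norm_num),
      eLpNorm_eq_lintegral_rpow_enorm_toReal (by norm_num) (by norm_num)]
    simp only [ENNReal.toReal_ofNat, ENNReal.rpow_ofNat, lintegral_fiberization]

theorem coeFn_fiberIsometry (f : L2R k) :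
    fiberIsometry k f =ᵐ[torusMeasure k] fiberization f :=
  (memLp_fiberization f).coeFn_toLp

theorem inner_eq_integral_fiberization (f g : L2R k) :
    ⟪f, g⟫_ℂ = ∫ x, ⟪fiberization f x, fiberization g x⟫_ℂ ∂torusMeasure k := by
  rw [← (fiberIsometry k).inner_map_map, L2.inner_def]
  refine integral_congr_ae ?_
  filter_upwards [coeFn_fiberIsometry f, coeFn_fiberIsometry g] with x h1 h2
  rw [h1, h2]

theorem eq_of_fiberization_ae_eq {f g : L2R k}
    (h : fiberization f =ᵐ[torusMeasure k] fiberization g) : f = g :=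
  (fiberIsometry k).injective (Lp.ext ((coeFn_fiberIsometry f).trans
    (h.trans (coeFn_fiberIsometry g).symm)))

/-- Surjectivity of fiberization: the coordinates of `z` are placed side by side on the translates
of the cube to form a function on the whole space, which is `L²` by the tiling; then the Fourier
transform is inverted. -/
theorem exists_fiberization_eq {z : EuclideanSpace ℝ (Fin k) → Ell2 (Fin k → ℤ)}
    (hz : MemLp z 2 (torusMeasure k)) :
    ∃ f : L2R k, fiberization f =ᵐ[torusMeasure k] z := by
  -- An everywhere measurable representative is needed because the glued function `F` evaluates it
  -- at points obtained by rounding.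
  set w := hz.1.mk z with hw
  have hwz : z =ᵐ[torusMeasure k] w := hz.1.ae_eq_mk
  have hwm : StronglyMeasurable w := hz.1.stronglyMeasurable_mk
  set F : EuclideanSpace ℝ (Fin k) → ℂ :=
    fun y => w (y - latticePt (latticeRound y)) (latticeRound y) with hF
  have hcoord : ∀ ℓ : Fin k → ℤ, Measurable fun x => w x ℓ := fun ℓ => by
    have : Continuous fun v : Ell2 (Fin k → ℤ) => v ℓ :=
      (lp.evalCLM ℂ (fun _ : Fin k → ℤ => ℂ) 2 ℓ).continuous
    exact (this.comp_stronglyMeasurable hwm).measurable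
  have hFm : Measurable F := by
    have h1 : Measurable fun p : EuclideanSpace ℝ (Fin k) × (Fin k → ℤ) =>
        w (p.1 - latticePt p.2) p.2 :=
      measurable_from_prod_countable_left fun ℓ => (hcoord ℓ).comp (measurable_sub_const (latticePt ℓ))
    exact h1.comp (measurable_id.prodMk measurable_latticeRound)
  have hFx : ∀ᵐ x ∂torusMeasure k, ∀ ℓ : Fin k → ℤ, F (x + latticePt ℓ) = w x ℓ := by
    filter_upwards [ae_restrict_mem measurableSet_torus] with x hx ℓ
    simp only [hF, latticeRound_add hx, add_sub_cancel_right]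
  have hF2 : MemLp F 2 volume := by
    refine memLp_two_of_lintegral hFm.aestronglyMeasurable ?_
    rw [lintegral_eq_lintegral_torus_tsum (hFm.enorm.pow_const 2)]
    have : ∫⁻ x, ∑' ℓ : Fin k → ℤ, ‖F (x + latticePt ℓ)‖ₑ ^ 2 ∂torusMeasure k =
        ∫⁻ x, ‖z x‖ₑ ^ 2 ∂torusMeasure k := by
      refine lintegral_congr_ae ?_
      filter_upwards [hFx, hwz] with x hx hx'
      simp only [hx, hx', enorm_sq_ell2]
    rw [this]
    exact lintegral_enorm_sq_ne_top hz
  refine ⟨𝓕⁻ (hF2.toLp F), ?_⟩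
  have h1 := ae_torus_of_ae hF2.coeFn_toLp
  filter_upwards [fiberization_apply (𝓕⁻ (hF2.toLp F) : L2R k), h1, hFx, hwz] with x e1 e2 e3 e4
  ext ℓ
  rw [e1, FourierTransform.fourier_fourierInv_eq, e2, e3, e4]

/-! ### Fourier series on the torus -/

instance isFiniteMeasure_torusMeasure : IsFiniteMeasure (torusMeasure k) := by
  refine ⟨?_⟩
  rw [torusMeasure, Measure.restrict_apply_univ]
  refine (Bornology.IsBounded.measure_lt_top ?_)
  have h : torus k ⊆ (fun x : EuclideanSpace ℝ (Fin k) => (WithLp.ofLp x : Fin k → ℝ)) ⁻¹'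
      Set.pi Set.univ fun _ => Set.Icc (-(1 / 2)) (1 / 2) := by
    intro x hx j _
    exact ⟨(hx j).1, (hx j).2.le⟩
  refine Bornology.IsBounded.subset ?_ h
  refine (AntilipschitzWith.isBounded_preimage (PiLp.antilipschitzWith_ofLp 2 _) ?_)
  exact Bornology.IsBounded.pi fun _ => Metric.isBounded_Icc _ _

attribute [local instance] instMeasureSpaceUnitAddCircle

/-- The representative in the cube of a point of the torus `ℝᵏ/ℤᵏ`. -/
noncomputable def torusSection (t : UnitAddTorus (Fin k)) : EuclideanSpace ℝ (Fin k) :=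
  WithLp.toLp 2 fun j => (AddCircle.equivIoc 1 (-(1 / 2)) (t j) : ℝ)

/-- The section of the additive circle used here takes values in `Ioc`, while the cube is built from
`Ico`; the two cubes differ by a null set. -/
theorem torusMeasure_eq : torusMeasure k =
    (volume.restrict {x : Fin k → ℝ | ∀ i, x i ∈ Set.Ioc (-(1 / 2) : ℝ) (-(1 / 2) + 1)}).map
      (WithLp.toLp 2) := by
  have h1 : (volume : Measure (Fin k → ℝ)).restrict
      {x | ∀ i, x i ∈ Set.Ioc (-(1 / 2) : ℝ) (-(1 / 2) + 1)} =
      volume.restrict {x | ∀ i, x i ∈ Set.Ico (-(1 / 2) : ℝ) (1 / 2)} := by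
    refine Measure.restrict_congr_set ?_
    have h := (Measure.univ_pi_Ioc_ae_eq_Icc (μ := fun _ : Fin k => (volume : Measure ℝ))
      (f := fun _ => -(1 / 2)) (g := fun _ => 1 / 2)).trans
      (Measure.univ_pi_Ico_ae_eq_Icc (μ := fun _ : Fin k => (volume : Measure ℝ))
      (f := fun _ => -(1 / 2)) (g := fun _ => 1 / 2)).symm
    have e1 : {x : Fin k → ℝ | ∀ i, x i ∈ Set.Ioc (-(1 / 2) : ℝ) (-(1 / 2) + 1)} =
        Set.univ.pi fun _ => Set.Ioc (-(1 / 2)) (1 / 2) := by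
      ext x; norm_num [Set.mem_pi]
    have e2 : {x : Fin k → ℝ | ∀ i, x i ∈ Set.Ico (-(1 / 2) : ℝ) (1 / 2)} =
        Set.univ.pi fun _ => Set.Ico (-(1 / 2)) (1 / 2) := by
      ext x; simp [Set.mem_pi]
    rw [e1, e2]
    exact h
  rw [h1, torusMeasure]
  have h2 := (EuclideanSpace.volume_preserving_symm_measurableEquiv_toLp (Fin k)).symm
  have h3 := h2.restrict_preimage (s := torus k) measurableSet_torus
  rw [← h3.map_eq]
  rfl

theorem measurePreserving_torusSection :
    MeasurePreserving (torusSection (k := k)) volume (torusMeasure k) := by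
  have h1 := UnitAddTorus.measurePreserving_equivPiIoc (d := Fin k) fun _ => -(1 / 2)
  have hs : MeasurableSet {x : Fin k → ℝ | ∀ i, x i ∈ Set.Ioc (-(1 / 2) : ℝ) (-(1 / 2) + 1)} :=
    MeasurableSet.univ_pi' fun i => measurableSet_Ioc
  have h2 := measurePreserving_subtype_coe (μa := (volume : Measure (Fin k → ℝ))) hs
  have h3 : MeasurePreserving (WithLp.toLp 2)
      ((volume : Measure (Fin k → ℝ)).restrict
        {x | ∀ i, x i ∈ Set.Ioc (-(1 / 2) : ℝ) (-(1 / 2) + 1)}) (torusMeasure k) :=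
    ⟨(MeasurableEquiv.toLp 2 (Fin k → ℝ)).measurable, torusMeasure_eq.symm⟩
  exact h3.comp (h2.comp h1)

theorem mFourier_neg_apply (ℓ : Fin k → ℤ) (t : UnitAddTorus (Fin k)) :
    UnitAddTorus.mFourier (-ℓ) t = latticeChar ℓ (torusSection t) := by
  have ht : ∀ j, t j = ((torusSection t j : ℝ) : UnitAddCircle) := fun j =>
    ((AddCircle.equivIoc 1 (-(1 / 2))).symm_apply_apply (t j)).symm
  simp only [UnitAddTorus.mFourier, ContinuousMap.coe_mk]
  rw [latticeChar, Real.fourierChar_apply]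
  conv_lhs => enter [2, j]; rw [ht j]
  simp only [fourier_coe_apply]
  rw [← Complex.exp_sum]
  congr 1
  simp only [PiLp.inner_apply, latticePt_apply, RCLike.inner_apply, conj_trivial]
  push_cast
  rw [mul_neg, neg_mul, Finset.mul_sum, Finset.sum_mul, ← Finset.sum_neg_distrib]
  refine Finset.sum_congr rfl fun j _ => ?_
  simp
  ring

/-- Fourier coefficients on the cube. -/
noncomputable def torusCoeff (p : EuclideanSpace ℝ (Fin k) → ℂ) (ℓ : Fin k → ℤ) : ℂ :=
  ∫ x, latticeChar ℓ x * p x ∂torusMeasure k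

theorem mFourierCoeff_comp_torusSection {p : EuclideanSpace ℝ (Fin k) → ℂ}
    (hp : AEStronglyMeasurable p (torusMeasure k)) (ℓ : Fin k → ℤ) :
    UnitAddTorus.mFourierCoeff (p ∘ torusSection) ℓ = torusCoeff p ℓ := by
  rw [UnitAddTorus.mFourierCoeff, torusCoeff, ← measurePreserving_torusSection.map_eq,
    integral_map measurePreserving_torusSection.measurable.aemeasurable]
  · simp only [mFourier_neg_apply, smul_eq_mul, Function.comp_apply]

  · rw [measurePreserving_torusSection.map_eq]
    exact (continuous_latticeChar ℓ).aestronglyMeasurable.mul hp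

/-- Parseval's identity on the cube. -/
theorem hasSum_torusCoeff {p q : EuclideanSpace ℝ (Fin k) → ℂ} (hp : MemLp p 2 (torusMeasure k))
    (hq : MemLp q 2 (torusMeasure k)) :
    HasSum (fun ℓ => starRingEnd ℂ (torusCoeff p ℓ) * torusCoeff q ℓ)
      (∫ x, starRingEnd ℂ (p x) * q x ∂torusMeasure k) := by
  have hτ := measurePreserving_torusSection (k := k)
  have hp' := hp.comp_measurePreserving hτ
  have hq' := hq.comp_measurePreserving hτ
  have h := UnitAddTorus.hasSum_prod_mFourierCoeff (hp'.toLp _) (hq'.toLp _)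
  have e : ∀ {p : EuclideanSpace ℝ (Fin k) → ℂ} (hp : MemLp p 2 (torusMeasure k)) (ℓ : Fin k → ℤ),
      UnitAddTorus.mFourierCoeff ((hp.comp_measurePreserving hτ).toLp _) ℓ = torusCoeff p ℓ := by
    intro p hp ℓ
    rw [← mFourierCoeff_comp_torusSection hp.1, UnitAddTorus.mFourierCoeff,
      UnitAddTorus.mFourierCoeff]
    refine integral_congr_ae ?_
    filter_upwards [(hp.comp_measurePreserving hτ).coeFn_toLp] with t ht
    rw [ht]
  simp only [e hp, e hq] at h
  convert h using 1
  rw [← hτ.map_eq, integral_map hτ.measurable.aemeasurable]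
  · refine integral_congr_ae ?_
    filter_upwards [hp'.coeFn_toLp, hq'.coeFn_toLp] with t h1 h2
    rw [h1, h2]
    rfl
  · rw [hτ.map_eq]
    exact (Complex.continuous_conj.comp_aestronglyMeasurable hp.1).mul hq.1

/-- The translate contributes a character to the fiber, conjugated because it sits in the first slot
of the inner product; hence the index `-ℓ`. With Parseval's identity, this turns sums over
translates into integrals over the cube. -/
theorem inner_shiftBy_eq_torusCoeff (ℓ : Fin k → ℤ) (g f : L2R k) :
    ⟪shiftBy ℓ g, f⟫_ℂ =
      torusCoeff (fun x => ⟪fiberization g x, fiberization f x⟫_ℂ) (-ℓ) := by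
  rw [inner_eq_integral_fiberization, torusCoeff]
  refine integral_congr_ae ?_
  filter_upwards [fiberization_shiftBy ℓ g] with x hx
  rw [hx, inner_smul_left]
  congr 1
  simp only [latticeChar]
  rw [← Circle.coe_inv_eq_conj, ← AddChar.map_neg_eq_inv]
  congr 2
  have : latticePt (-ℓ) = -latticePt ℓ := by ext; simp [latticePt]
  rw [this, inner_neg_left]

end FiberIsometry

/-! ### Bessel families of translates, read on fibers -/

section BesselFibers

variable {k n : ℕ}

theorem hasSum_prod_fin {β M : Type*} [AddCommMonoid M] [TopologicalSpace M] [ContinuousAdd M]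
    {a : β × Fin n → M} {s : Fin n → M} (h : ∀ i, HasSum (fun b => a (b, i)) (s i)) :
    HasSum a (∑ i, s i) := by
  classical
  have h1 : ∀ i, HasSum (fun p : β × Fin n => if p.2 = i then a p else 0) (s i) := by
    intro i
    have hinj : Function.Injective fun b : β => (b, i) := fun b c hbc => (Prod.mk.inj hbc).1
    rw [← hinj.hasSum_iff]
    · simpa [Function.comp_def] using h i
    · rintro ⟨b, j⟩ hj
      rw [if_neg]
      rintro rfl
      exact hj ⟨b, rfl⟩
  have h2 := hasSum_sum (s := Finset.univ) fun i _ => h1 i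
  simpa using h2

/-- The fibers of `g` are essentially bounded. -/
def HasBoundedFibers (g : L2R k) : Prop :=
  ∃ C : ℝ, ∀ᵐ x ∂torusMeasure k, ‖fiberization g x‖ ≤ C

theorem memLp_inner_fiberization {g : L2R k} (hg : HasBoundedFibers g) (f : L2R k) :
    MemLp (fun x => ⟪fiberization g x, fiberization f x⟫_ℂ) 2 (torusMeasure k) := by
  obtain ⟨C, hC⟩ := hg
  refine (memLp_fiberization f).of_le_mul (c := C)
    ((aestronglyMeasurable_fiberization g).inner (aestronglyMeasurable_fiberization f)) ?_
  filter_upwards [hC] with x hx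
  refine (norm_inner_le_norm _ _).trans ?_
  gcongr

theorem hasSum_torusCoeff_neg {p q : EuclideanSpace ℝ (Fin k) → ℂ}
    (hp : MemLp p 2 (torusMeasure k)) (hq : MemLp q 2 (torusMeasure k)) :
    HasSum (fun ℓ => starRingEnd ℂ (torusCoeff p (-ℓ)) * torusCoeff q (-ℓ))
      (∫ x, starRingEnd ℂ (p x) * q x ∂torusMeasure k) :=
  (Equiv.neg (Fin k → ℤ)).hasSum_iff.mpr (hasSum_torusCoeff hp hq)

theorem hasSum_norm_sq_inner_shiftBy {g f : L2R k}
    (h : MemLp (fun x => ⟪fiberization g x, fiberization f x⟫_ℂ) 2 (torusMeasure k)) :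
    HasSum (fun ℓ => ‖⟪shiftBy ℓ g, f⟫_ℂ‖ ^ 2)
      (∫ x, ‖⟪fiberization g x, fiberization f x⟫_ℂ‖ ^ 2 ∂torusMeasure k) := by
  have h1 := hasSum_torusCoeff_neg h h
  simp only [← inner_shiftBy_eq_torusCoeff, Complex.conj_mul'] at h1
  have h2 : (∫ x, ((‖⟪fiberization g x, fiberization f x⟫_ℂ‖ : ℂ)) ^ 2 ∂torusMeasure k) =
      ((∫ x, ‖⟪fiberization g x, fiberization f x⟫_ℂ‖ ^ 2 ∂torusMeasure k : ℝ) : ℂ) := by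
    rw [← integral_complex_ofReal]
    simp
  rw [h2] at h1
  exact_mod_cast h1

theorem integral_norm_sq_fiberization (f : L2R k) :
    ∫ x, ‖fiberization f x‖ ^ 2 ∂torusMeasure k = ‖f‖ ^ 2 := by
  have h1 := inner_eq_integral_fiberization f f
  simp only [inner_self_eq_norm_sq_to_K] at h1
  have h2 : (∫ x, ((‖fiberization f x‖ : ℂ)) ^ 2 ∂torusMeasure k) =
      ((∫ x, ‖fiberization f x‖ ^ 2 ∂torusMeasure k : ℝ) : ℂ) := by
    rw [← integral_complex_ofReal]
    simp
  exact Complex.ofReal_injective ((h1.trans h2).symm.trans (by push_cast; rfl))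

theorem integral_norm_sq_inner_fiberization_le {g : L2R k} {C : ℝ}
    (hC : ∀ᵐ x ∂torusMeasure k, ‖fiberization g x‖ ≤ C) (h : L2R k) :
    ∫ x, ‖⟪fiberization g x, fiberization h x⟫_ℂ‖ ^ 2 ∂torusMeasure k ≤ C ^ 2 * ‖h‖ ^ 2 := by
  rw [← integral_norm_sq_fiberization, ← integral_const_mul]
  have i1 := (memLp_inner_fiberization ⟨C, hC⟩ h).integrable_norm_pow two_ne_zero
  have i2 := ((memLp_fiberization h).integrable_norm_pow two_ne_zero).const_mul (C ^ 2)
  refine integral_mono_ae i1 i2 ?_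
  filter_upwards [hC] with x hx
  have h1 : ‖⟪fiberization g x, fiberization h x⟫_ℂ‖ ≤ C * ‖fiberization h x‖ :=
    (norm_inner_le_norm _ _).trans (by gcongr)
  calc _ ≤ (C * ‖fiberization h x‖) ^ 2 := pow_le_pow_left₀ (norm_nonneg _) h1 2
    _ = _ := mul_pow _ _ _

theorem isBessel_translates {G : Fin n → L2R k} (hG : ∀ i, HasBoundedFibers (G i)) :
    IsBessel (translates G) := by
  choose C hC using hG
  -- The `+ 1` only ensures that the Bessel bound is positive.
  refine ⟨∑ i, C i ^ 2 + 1,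
    add_pos_of_nonneg_of_pos (Finset.sum_nonneg fun i _ => sq_nonneg _) one_pos, fun h => ?_⟩
  have h0 : ∀ i, HasSum (fun ℓ : Fin k → ℤ => ‖⟪translates G (ℓ, i), h⟫_ℂ‖ ^ 2)
      (∫ x, ‖⟪fiberization (G i) x, fiberization h x⟫_ℂ‖ ^ 2 ∂torusMeasure k) := by
    intro i
    have e : ∀ ℓ, translates G (ℓ, i) = shiftBy ℓ (G i) := fun _ => rfl
    simp only [e]
    have hb : HasBoundedFibers (G i) := ⟨C i, hC i⟩
    exact hasSum_norm_sq_inner_shiftBy (memLp_inner_fiberization hb h)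
  have h1 := hasSum_prod_fin (a := fun p => ‖⟪translates G p, h⟫_ℂ‖ ^ 2) h0
  refine ⟨h1.summable, h1.tsum_eq.trans_le ?_⟩
  refine (Finset.sum_le_sum fun i _ =>
    integral_norm_sq_inner_fiberization_le (hC i) h).trans ?_
  rw [← Finset.sum_mul, add_mul, one_mul]
  exact le_add_of_nonneg_right (sq_nonneg _)

/-- Test the Bessel inequality on the function whose fiber is that of `G i` cut off to a set `A`
where its squared norm exceeds `b`. It reads `∫_A ‖w‖⁴ ≤ b ∫_A ‖w‖²`, which forces `A` to be null.
-/
theorem hasBoundedFibers_of_isBessel {G : Fin n → L2R k} (hG : IsBessel (translates G))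
    (i : Fin n) : HasBoundedFibers (G i) := by
  obtain ⟨b, hb0, hb⟩ := hG
  have hinj : Function.Injective fun ℓ : Fin k → ℤ => (ℓ, i) := fun b c hbc => (Prod.mk.inj hbc).1
  have hb' : ∀ h : L2R k, ∑' ℓ, ‖⟪shiftBy ℓ (G i), h⟫_ℂ‖ ^ 2 ≤ b * ‖h‖ ^ 2 := fun h =>
    (tsum_comp_le_tsum_of_inj (hb h).1 (fun p => by positivity) hinj).trans (hb h).2
  have hm := aestronglyMeasurable_fiberization (G i)
  set w := hm.mk _ with hw
  have hwe : fiberization (G i) =ᵐ[torusMeasure k] w := hm.ae_eq_mk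
  have hwm : StronglyMeasurable w := hm.stronglyMeasurable_mk
  -- The cutoff at height `M` makes the test field bounded, hence square integrable; a countable
  -- union over `M` removes it.
  have key : ∀ M : ℕ, ∀ᵐ x ∂torusMeasure k, ¬ (b < ‖w x‖ ^ 2 ∧ ‖w x‖ ≤ M) := by
    intro M
    set A : Set (EuclideanSpace ℝ (Fin k)) := {x | b < ‖w x‖ ^ 2 ∧ ‖w x‖ ≤ M} with hA
    have hAm : MeasurableSet A :=
      (measurableSet_lt measurable_const (hwm.norm.measurable.pow_const 2)).inter
        (measurableSet_le hwm.norm.measurable measurable_const)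
    have hz : MemLp (A.indicator w) 2 (torusMeasure k) := by
      refine MemLp.of_bound (hwm.indicator hAm).aestronglyMeasurable M
        (Filter.Eventually.of_forall fun x => ?_)
      by_cases hx : x ∈ A
      · rw [Set.indicator_of_mem hx]; exact hx.2
      · rw [Set.indicator_of_notMem hx]; simp
    obtain ⟨f, hf⟩ := exists_fiberization_eq hz
    have hp : (fun x => ⟪fiberization (G i) x, fiberization f x⟫_ℂ) =ᵐ[torusMeasure k]
        fun x => ((A.indicator (fun x => ‖w x‖ ^ 2) x : ℝ) : ℂ) := by
      filter_upwards [hwe, hf] with x h1 h2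
      rw [h1, h2]
      by_cases hx : x ∈ A
      · simp only [Set.indicator_of_mem hx, inner_self_eq_norm_sq_to_K]
        push_cast
        rfl
      · simp [Set.indicator_of_notMem hx]
    have hpm : Measurable fun x => A.indicator (fun x => ‖w x‖ ^ 2) x :=
      (hwm.norm.measurable.pow_const 2).indicator hAm
    have hpb : ∀ x, ‖A.indicator (fun x => ‖w x‖ ^ 2) x‖ ≤ (M : ℝ) ^ 2 := by
      intro x
      by_cases hx : x ∈ A
      · rw [Set.indicator_of_mem hx, norm_pow, norm_norm]
        exact pow_le_pow_left₀ (norm_nonneg _) hx.2 2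
      · rw [Set.indicator_of_notMem hx]; simp
    have hpL : MemLp (fun x => ⟪fiberization (G i) x, fiberization f x⟫_ℂ) 2 (torusMeasure k) := by
      refine (memLp_congr_ae hp).mpr (MemLp.of_bound
        (Complex.measurable_ofReal.comp hpm).aestronglyMeasurable (M ^ 2)
        (Filter.Eventually.of_forall fun x => ?_))
      rw [Complex.norm_real]
      exact hpb x
    have h1 := hb' f
    rw [(hasSum_norm_sq_inner_shiftBy hpL).tsum_eq, ← integral_norm_sq_fiberization,
      ← integral_const_mul] at h1
    have e1 : ∫ x, ‖⟪fiberization (G i) x, fiberization f x⟫_ℂ‖ ^ 2 ∂torusMeasure k =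
        ∫ x, A.indicator (fun x => (‖w x‖ ^ 2) ^ 2) x ∂torusMeasure k := by
      refine integral_congr_ae ?_
      filter_upwards [hp] with x hx
      rw [hx, Complex.norm_real, Real.norm_eq_abs, sq_abs]
      by_cases hx : x ∈ A
      · simp [Set.indicator_of_mem hx]
      · simp [Set.indicator_of_notMem hx]
    have e2 : ∫ x, b * ‖fiberization f x‖ ^ 2 ∂torusMeasure k =
        ∫ x, A.indicator (fun x => b * ‖w x‖ ^ 2) x ∂torusMeasure k := by
      refine integral_congr_ae ?_
      filter_upwards [hf] with x hx
      rw [hx]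
      by_cases hx : x ∈ A
      · simp [Set.indicator_of_mem hx]
      · simp [Set.indicator_of_notMem hx]
    have i1 : Integrable (fun x => A.indicator (fun x => (‖w x‖ ^ 2) ^ 2) x) (torusMeasure k) := by
      refine Integrable.of_bound (((hwm.norm.measurable.pow_const 2).pow_const 2).indicator
        hAm).aestronglyMeasurable (((M : ℝ) ^ 2) ^ 2) (Filter.Eventually.of_forall fun x => ?_)
      by_cases hx : x ∈ A
      · rw [Set.indicator_of_mem hx, norm_pow, norm_pow, norm_norm]
        exact pow_le_pow_left₀ (by positivity) (pow_le_pow_left₀ (norm_nonneg _) hx.2 2) 2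
      · rw [Set.indicator_of_notMem hx]; simp
    have i2 : Integrable (fun x => A.indicator (fun x => b * ‖w x‖ ^ 2) x) (torusMeasure k) := by
      refine Integrable.of_bound (((hwm.norm.measurable.pow_const 2).const_mul b).indicator
        hAm).aestronglyMeasurable (b * (M : ℝ) ^ 2) (Filter.Eventually.of_forall fun x => ?_)
      by_cases hx : x ∈ A
      · rw [Set.indicator_of_mem hx, Real.norm_of_nonneg (by positivity)]
        have := pow_le_pow_left₀ (norm_nonneg _) hx.2 2
        gcongr
      · rw [Set.indicator_of_notMem hx]; simp; positivity
    have hnn : 0 ≤ fun x => A.indicator (fun x => (‖w x‖ ^ 2) ^ 2) x -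
        A.indicator (fun x => b * ‖w x‖ ^ 2) x := by
      intro x
      by_cases hx : x ∈ A
      · simp only [Set.indicator_of_mem hx, Pi.zero_apply]
        nlinarith [hx.1, sq_nonneg ‖w x‖]
      · simp [Set.indicator_of_notMem hx]
    have h0 := (integral_eq_zero_iff_of_nonneg hnn (i1.sub i2)).mp
      (le_antisymm (by rw [integral_sub i1 i2, ← e1, ← e2]; linarith) (integral_nonneg hnn))
    filter_upwards [h0] with x hx hxA
    have hxA' : x ∈ A := hxA
    simp only [Set.indicator_of_mem hxA', Pi.zero_apply] at hx
    nlinarith [hxA.1]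
  refine ⟨Real.sqrt b, ?_⟩
  filter_upwards [ae_all_iff.mpr key, hwe] with x hx hx'
  rw [hx']
  obtain ⟨M, hM⟩ := exists_nat_ge ‖w x‖
  have := hx M
  refine Real.le_sqrt_of_sq_le ?_
  by_contra hlt
  exact this ⟨not_le.mp hlt, hM⟩

theorem isBessel_translates_iff {G : Fin n → L2R k} :
    IsBessel (translates G) ↔ ∀ i, HasBoundedFibers (G i) :=
  ⟨hasBoundedFibers_of_isBessel, isBessel_translates⟩

/-- The fibers of the mixed operator of two Bessel families `E(G)` and `E(R)`. -/
theorem fiberization_synthesisOp_analysisOp {G R : Fin n → L2R k}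
    (hG : IsBessel (translates G)) (hR : IsBessel (translates R)) (u : L2R k) :
    ∀ᵐ x ∂torusMeasure k, fiberization (synthesisOp (translates R) (analysisOp (translates G) u)) x =
      ∑ i, ⟪fiberization (G i) x, fiberization u x⟫_ℂ • fiberization (R i) x := by
  have hG' := isBessel_translates_iff.mp hG
  have hR' := isBessel_translates_iff.mp hR
  have hterm : ∀ i, MemLp (fun x => ⟪fiberization (G i) x, fiberization u x⟫_ℂ •
      fiberization (R i) x) 2 (torusMeasure k) := by
    intro i
    obtain ⟨C, hC⟩ := hR' i
    have hm : AEStronglyMeasurable (fun x => ⟪fiberization (G i) x, fiberization u x⟫_ℂ)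
      (torusMeasure k) := (memLp_inner_fiberization (hG' i) u).1
    refine (memLp_inner_fiberization (hG' i) u).of_le_mul (c := C)
      (hm.smul (aestronglyMeasurable_fiberization (R i))) ?_
    filter_upwards [hC] with x hx
    rw [norm_smul, mul_comm]
    gcongr
  obtain ⟨f, hf⟩ := exists_fiberization_eq (memLp_finsetSum Finset.univ fun i _ => hterm i)
  -- Equality is checked weakly: against any `v`, the double series is summed by Parseval separately
  -- for each generator.
  have : synthesisOp (translates R) (analysisOp (translates G) u) = f := by
    refine ext_inner_left ℂ fun v => ?_
    have h1 := (hasSum_synthesisOp_analysisOp hR hG u).mapL (innerSL ℂ v)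
    simp only [innerSL_apply_apply, inner_smul_right] at h1
    have h2 : HasSum (fun p => ⟪translates G p, u⟫_ℂ * ⟪v, translates R p⟫_ℂ)
        (∑ i, ∫ x, starRingEnd ℂ ⟪fiberization (R i) x, fiberization v x⟫_ℂ *
          ⟪fiberization (G i) x, fiberization u x⟫_ℂ ∂torusMeasure k) := by
      refine hasSum_prod_fin fun i => ?_
      have h3 := hasSum_torusCoeff_neg (memLp_inner_fiberization (hR' i) v)
        (memLp_inner_fiberization (hG' i) u)
      simp only [← inner_shiftBy_eq_torusCoeff, inner_conj_symm] at h3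
      simp only [inner_conj_symm]
      refine h3.congr_fun fun ℓ => ?_
      rw [mul_comm]
      rfl
    rw [h1.unique h2, inner_eq_integral_fiberization, ← integral_finsetSum]
    · refine integral_congr_ae ?_
      filter_upwards [hf] with x hx
      rw [hx, inner_sum]
      refine Finset.sum_congr rfl fun i _ => ?_
      rw [inner_conj_symm, inner_smul_right, mul_comm]
    · intro i _
      have := (memLp_inner_fiberization (hR' i) v).star.integrable_mul
        (memLp_inner_fiberization (hG' i) u)
      exact this
  rw [this]
  exact hf

/-- Fiberwise inner products are determined by the inner products with all translates. -/
theorem inner_fiberization_eq {u v u' v' : L2R k} (hu : HasBoundedFibers u)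
    (hu' : HasBoundedFibers u')
    (h : ∀ ℓ : Fin k → ℤ, ⟪shiftBy ℓ u, v⟫_ℂ = ⟪shiftBy ℓ u', v'⟫_ℂ) :
    ∀ᵐ x ∂torusMeasure k,
      ⟪fiberization u x, fiberization v x⟫_ℂ = ⟪fiberization u' x, fiberization v' x⟫_ℂ := by
  have hp := memLp_inner_fiberization hu v
  have hq := memLp_inner_fiberization hu' v'
  -- Every Fourier coefficient of the difference is zero, so Parseval makes its `L²` norm zero.
  have h1 := hasSum_torusCoeff_neg (hp.sub hq) (hp.sub hq)
  have h2 : ∀ ℓ, torusCoeff ((fun x => ⟪fiberization u x, fiberization v x⟫_ℂ) -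
      fun x => ⟪fiberization u' x, fiberization v' x⟫_ℂ) (-ℓ) = 0 := by
    intro ℓ
    have h3 := h ℓ
    rw [inner_shiftBy_eq_torusCoeff, inner_shiftBy_eq_torusCoeff] at h3
    have hint : ∀ {p : EuclideanSpace ℝ (Fin k) → ℂ}, MemLp p 2 (torusMeasure k) →
        Integrable (fun x => latticeChar (-ℓ) x * p x) (torusMeasure k) := fun {p} hp => by
      refine (hp.integrable one_le_two).bdd_mul (c := 1)
        (continuous_latticeChar _).aestronglyMeasurable
        (Filter.Eventually.of_forall fun x => (norm_latticeChar _ x).le)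
    rw [torusCoeff] at h3 ⊢
    simp only [Pi.sub_apply, mul_sub]
    rw [integral_sub (hint hp) (hint hq), h3, torusCoeff, sub_self]
  simp only [h2, map_zero, zero_mul] at h1
  have h4 := h1.unique hasSum_zero
  have h5 : ∫ x, ‖⟪fiberization u x, fiberization v x⟫_ℂ -
      ⟪fiberization u' x, fiberization v' x⟫_ℂ‖ ^ 2 ∂torusMeasure k = 0 := by
    simp only [Complex.conj_mul', Pi.sub_apply] at h4
    have : (∫ x, ((‖⟪fiberization u x, fiberization v x⟫_ℂ -
        ⟪fiberization u' x, fiberization v' x⟫_ℂ‖ : ℂ)) ^ 2 ∂torusMeasure k) =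
      ((∫ x, ‖⟪fiberization u x, fiberization v x⟫_ℂ -
      ⟪fiberization u' x, fiberization v' x⟫_ℂ‖ ^ 2 ∂torusMeasure k : ℝ) : ℂ) := by
      rw [← integral_complex_ofReal]
      simp
    rw [this] at h4
    exact_mod_cast h4
  rw [integral_eq_zero_iff_of_nonneg (fun x => by positivity)
    (by simpa using (hp.sub hq).integrable_norm_pow two_ne_zero)] at h5
  filter_upwards [h5] with x hx
  simpa [sub_eq_zero] using hx

/-- The constant field `δ_ℓ` is the fiber of a function. -/
theorem exists_fiberization_eq_single (ℓ : Fin k → ℤ) :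
    ∃ f : L2R k, fiberization f =ᵐ[torusMeasure k] fun _ => lp.single 2 ℓ (1 : ℂ) := by
  classical
  exact exists_fiberization_eq (memLp_const _)

theorem ext_on_single {ι G : Type} [DecidableEq ι] [NormedAddCommGroup G] [NormedSpace ℂ G]
    {s t : Ell2 ι →L[ℂ] G} (h : ∀ i, s (lp.single 2 i 1) = t (lp.single 2 i 1)) : s = t := by
  ext v
  have h1 := lp.hasSum_single (p := 2) (by norm_num) v
  refine (h1.mapL s).unique ?_
  refine (h1.mapL t).congr_fun fun i => ?_
  have e : (lp.single 2 i (v i) : Ell2 ι) = v i • lp.single 2 i 1 := by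
    rw [← lp.single_smul, smul_eq_mul, mul_one]
  rw [e, map_smul, map_smul, h]

/-- Fields of operators are determined by their action on fibers. -/
theorem field_ae_eq {s t : EuclideanSpace ℝ (Fin k) → Ell2 (Fin k → ℤ) →L[ℂ] Ell2 (Fin k → ℤ)}
    (h : ∀ f : L2R k, ∀ᵐ x ∂torusMeasure k, s x (fiberization f x) = t x (fiberization f x)) :
    s =ᵐ[torusMeasure k] t := by
  classical
  -- Countably many test functions suffice: their fibers are the constant basis vectors of `ℓ²`, so
  -- one null set serves for all of them.
  choose f hf using exists_fiberization_eq_single (k := k)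
  have h1 := ae_all_iff.mpr fun ℓ => h (f ℓ)
  have h2 := ae_all_iff.mpr hf
  filter_upwards [h1, h2] with x hx hx'
  refine ext_on_single fun ℓ => ?_
  have := hx ℓ
  rw [hx' ℓ] at this
  convert this

end BesselFibers

/-! ### Shift-preserving operators -/

section ShiftInvariance

variable {k n : ℕ}

theorem IsFSI.isClosed {V : Submodule ℂ (L2R k)} (hV : IsFSI V) : IsClosed (V : Set (L2R k)) := by
  obtain ⟨A, -, rfl⟩ := hV
  exact Submodule.isClosed_topologicalClosure _

theorem IsFSI.shiftBy_mem {V : Submodule ℂ (L2R k)} (hV : IsFSI V) (ℓ : Fin k → ℤ) {f : L2R k}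
    (hf : f ∈ V) : shiftBy ℓ f ∈ V := by
  obtain ⟨A, -, rfl⟩ := hV
  set D := Submodule.span ℂ {g | ∃ f ∈ A, ∃ ℓ : Fin k → ℤ, g = shiftBy ℓ f}
  have hD : ∀ f ∈ D, shiftBy ℓ f ∈ D := by
    have : D ≤ D.comap (shiftEquiv ℓ).toLinearEquiv.toLinearMap := by
      refine Submodule.span_le.mpr ?_
      rintro _ ⟨f, hf, m, rfl⟩
      refine Submodule.subset_span ⟨f, hf, ℓ + m, ?_⟩
      exact shiftBy_shiftBy ℓ m f
    exact this
  exact map_mem_closure (shiftEquiv ℓ).continuous hf hD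

/-- Translation as an element of the algebra of bounded operators. -/
noncomputable def shiftCLM (ℓ : Fin k → ℤ) : L2R k →L[ℂ] L2R k :=
  (shiftEquiv ℓ).toContinuousLinearEquiv

theorem shiftCLM_apply (ℓ : Fin k → ℤ) (f : L2R k) : shiftCLM ℓ f = shiftBy ℓ f := rfl

theorem star_shiftCLM (ℓ : Fin k → ℤ) : star (shiftCLM ℓ) = shiftCLM (-ℓ) := by
  rw [ContinuousLinearMap.star_eq_adjoint]
  refine (ContinuousLinearMap.eq_adjoint_iff _ _).mpr (fun x y => ?_) |>.symm
  rw [shiftCLM_apply, shiftCLM_apply, inner_shiftBy, neg_neg]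

theorem shiftCLM_mem_unitary (ℓ : Fin k → ℤ) : shiftCLM ℓ ∈ unitary (L2R k →L[ℂ] L2R k) := by
  rw [Unitary.mem_iff, star_shiftCLM]
  constructor
  · ext1 f
    change shiftBy (-ℓ) (shiftBy ℓ f) = f
    rw [shiftBy_shiftBy, neg_add_cancel, shiftBy_zero]
  · ext1 f
    change shiftBy ℓ (shiftBy (-ℓ) f) = f
    rw [shiftBy_shiftBy, add_neg_cancel, shiftBy_zero]

theorem isShiftPreserving_iff {S : L2R k →L[ℂ] L2R k} :
    IsShiftPreserving S ↔ ∀ ℓ, Commute S (shiftCLM ℓ) := by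
  refine forall_congr' fun ℓ => ⟨fun h => ContinuousLinearMap.ext fun f => (h f).symm,
    fun h f => (DFunLike.congr_fun h f).symm⟩

theorem IsShiftPreserving.mul {S T : L2R k →L[ℂ] L2R k} (hS : IsShiftPreserving S)
    (hT : IsShiftPreserving T) : IsShiftPreserving (S * T) :=
  isShiftPreserving_iff.mpr fun ℓ =>
    (isShiftPreserving_iff.mp hS ℓ).mul_left (isShiftPreserving_iff.mp hT ℓ)

/-- The commutation clause makes the square root of a shift-preserving operator shift preserving, so
that fiber matrices of `B` become Gram matrices. -/
theorem ContinuousLinearMap.IsPositive.exists_sqrt {H : Type} [NormedAddCommGroup H]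
    [InnerProductSpace ℂ H] [CompleteSpace H] {B : H →L[ℂ] H} (hB : B.IsPositive) :
    ∃ D : H →L[ℂ] H, IsSelfAdjoint D ∧ D * D = B ∧ ∀ U, Commute B U → Commute D U := by
  have hB' : 0 ≤ B := (ContinuousLinearMap.nonneg_iff_isPositive B).mpr hB
  exact ⟨CFC.sqrt B, (CFC.sqrt_nonneg B).isSelfAdjoint, CFC.sqrt_mul_sqrt_self B hB',
    fun U hU => hU.cfcₙ_nnreal _⟩

theorem IsShiftPreserving.moorePenrose {S : L2R k →L[ℂ] L2R k} (hS : IsShiftPreserving S)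
    (hX : IsMoorePenrose S (moorePenrose S)) : IsShiftPreserving (moorePenrose S) :=
  isShiftPreserving_iff.mpr fun ℓ =>
    hX.commute_of_unitary (shiftCLM_mem_unitary ℓ) (isShiftPreserving_iff.mp hS ℓ)

/-- Translations preserve both `V` and `Wᗮ`, so they respect the decomposition that defines the
projection. -/
theorem isShiftPreserving_obliqueProj {V W : Submodule ℂ (L2R k)} [W.HasOrthogonalProjection] (hV : IsFSI V) (hW : IsFSI W)
    (hVW : IsCompl V Wᗮ) : IsShiftPreserving (obliqueProj V W hV.isClosed hVW) := by
  intro ℓ f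
  set P := obliqueProj V W hV.isClosed hVW
  have h1 : shiftBy ℓ (f - P f) ∈ Wᗮ := by
    rw [Submodule.mem_orthogonal']
    intro w hw
    rw [inner_shiftBy]
    exact (Submodule.mem_orthogonal' _ _).mp (sub_obliqueProj_mem hV.isClosed hVW f) _
      (hW.shiftBy_mem _ hw)
  rw [shiftBy_sub] at h1
  have h2 : P (shiftBy ℓ f - shiftBy ℓ (P f)) = 0 :=
    (Submodule.projection_apply_eq_zero_iff hVW).mpr h1
  rw [map_sub, sub_eq_zero] at h2
  rw [h2]
  exact (obliqueProj_of_mem hV.isClosed hVW (hV.shiftBy_mem ℓ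
    (obliqueProj_mem hV.isClosed hVW f))).symm

theorem isShiftPreserving_starProjection {V : Submodule ℂ (L2R k)} [V.HasOrthogonalProjection]
    (hV : IsFSI V) : IsShiftPreserving V.starProjection := by
  intro ℓ f
  refine (Submodule.eq_starProjection_of_mem_orthogonal
    (hV.shiftBy_mem ℓ (V.starProjection_apply_mem f)) ?_).symm
  rw [← shiftBy_sub, Submodule.mem_orthogonal']
  intro w hw
  rw [inner_shiftBy]
  exact (Submodule.mem_orthogonal' _ _).mp (V.sub_starProjection_mem_orthogonal f) _
    (hV.shiftBy_mem _ hw)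

theorem translates_map {T : L2R k →L[ℂ] L2R k} (hT : IsShiftPreserving T) (G : Fin n → L2R k) :
    translates (fun i => T (G i)) = fun p => T (translates G p) :=
  funext fun p => hT p.1 (G p.2)

theorem translates_zero_apply (G : Fin n → L2R k) (i : Fin n) : translates G (0, i) = G i :=
  shiftBy_zero _

theorem isBessel_translates_map {T : L2R k →L[ℂ] L2R k} (hT : IsShiftPreserving T)
    {G : Fin n → L2R k} (hG : IsBessel (translates G)) :
    IsBessel (translates fun i => T (G i)) := by
  rw [translates_map hT]
  exact hG.map T

/-- On fibers a translation is multiplication by a scalar, which passes through the finite sum that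
describes the operator. -/
theorem isShiftPreserving_mixed {G R : Fin n → L2R k} (hG : IsBessel (translates G))
    (hR : IsBessel (translates R)) :
    IsShiftPreserving (synthesisOp (translates R) ∘L analysisOp (translates G)) := by
  intro ℓ f
  refine eq_of_fiberization_ae_eq ?_
  filter_upwards [fiberization_synthesisOp_analysisOp hG hR f,
    fiberization_synthesisOp_analysisOp hG hR (shiftBy ℓ f), fiberization_shiftBy ℓ f,
    fiberization_shiftBy ℓ (synthesisOp (translates R) (analysisOp (translates G) f))]
    with x h1 h2 h3 h4
  rw [ContinuousLinearMap.comp_apply, h4, h1, ContinuousLinearMap.comp_apply, h2, h3,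
    Finset.smul_sum]
  simp only [inner_smul_right, mul_smul]

theorem isShiftPreserving_frameOp {G : Fin n → L2R k} (hG : IsBessel (translates G)) :
    IsShiftPreserving (frameOp (translates G)) := by
  rw [frameOp_eq]
  exact isShiftPreserving_mixed hG hG

theorem fiberization_zero : ∀ᵐ x ∂torusMeasure k, fiberization (0 : L2R k) x = 0 := by
  filter_upwards [fiberization_smul (0 : ℂ) (0 : L2R k)] with x hx
  rwa [zero_smul, zero_smul] at hx

end ShiftInvariance

/-! ### Fields of operators and range functions -/

section Fields

variable {k n : ℕ}

/-- The field of operators `v ↦ ∑ ⟨v, Γ Gᵢ x⟩ Γ Rᵢ x`. -/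
noncomputable def mixedField (G R : Fin n → L2R k) (x : EuclideanSpace ℝ (Fin k)) :
    Ell2 (Fin k → ℤ) →L[ℂ] Ell2 (Fin k → ℤ) :=
  ∑ i, (innerSL ℂ (fiberization (G i) x)).smulRight (fiberization (R i) x)

theorem mixedField_apply (G R : Fin n → L2R k) (x : EuclideanSpace ℝ (Fin k))
    (v : Ell2 (Fin k → ℤ)) : mixedField G R x v =
      ∑ i, ⟪fiberization (G i) x, v⟫_ℂ • fiberization (R i) x := by
  simp [mixedField]

theorem inner_mixedField (G R : Fin n → L2R k) (x : EuclideanSpace ℝ (Fin k))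
    (u v : Ell2 (Fin k → ℤ)) : ⟪mixedField G R x u, v⟫_ℂ = ⟪u, mixedField R G x v⟫_ℂ := by
  rw [mixedField_apply, mixedField_apply, sum_inner, inner_sum]
  refine Finset.sum_congr rfl fun i _ => ?_
  rw [inner_smul_left, inner_smul_right, inner_conj_symm, mul_comm]

theorem isFiberField_mixedField {G R : Fin n → L2R k} (hG : IsBessel (translates G))
    (hR : IsBessel (translates R)) :
    IsFiberField (synthesisOp (translates R) ∘L analysisOp (translates G)) (mixedField G R) where
  measurable ξ η := by
    simp only [mixedField_apply, inner_sum, inner_smul_right]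
    refine Finset.aemeasurable_fun_sum _ fun i _ => ?_
    exact ((aestronglyMeasurable_fiberization (G i)).inner
      aestronglyMeasurable_const).aemeasurable.mul
      (aestronglyMeasurable_const.inner (aestronglyMeasurable_fiberization (R i))).aemeasurable
  bounded := by
    have hG' := isBessel_translates_iff.mp hG
    have hR' := isBessel_translates_iff.mp hR
    choose C hC using hG'
    choose D hD using hR'
    refine ⟨∑ i, C i * D i, ?_⟩
    filter_upwards [ae_all_iff.mpr hC, ae_all_iff.mpr hD] with x h1 h2
    refine (norm_sum_le _ _).trans (Finset.sum_le_sum fun i _ => ?_)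
    rw [ContinuousLinearMap.norm_smulRight_apply, innerSL_apply_norm]
    exact mul_le_mul (h1 i) (h2 i) (norm_nonneg _) ((norm_nonneg _).trans (h1 i))
  intertwines f := by
    filter_upwards [fiberization_synthesisOp_analysisOp hG hR f] with x hx
    rw [mixedField_apply, ContinuousLinearMap.comp_apply, hx]

theorem fiberField_spec {S : L2R k →L[ℂ] L2R k} (h : ∃ s, IsFiberField S s) :
    IsFiberField S (fiberField S) := by
  rw [fiberField, dif_pos h]
  exact h.choose_spec

/-- This replaces the field picked by choice in `fiberField` by any explicit one. -/
theorem fiberField_ae_eq {S : L2R k →L[ℂ] L2R k}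
    {s : EuclideanSpace ℝ (Fin k) → Ell2 (Fin k → ℤ) →L[ℂ] Ell2 (Fin k → ℤ)}
    (hs : IsFiberField S s) : fiberField S =ᵐ[torusMeasure k] s := by
  refine field_ae_eq fun f => ?_
  filter_upwards [(fiberField_spec ⟨s, hs⟩).intertwines f, hs.intertwines f] with x h1 h2
  rw [h1, h2]

theorem rangeFunction_spec {V : Submodule ℂ (L2R k)} (h : ∃ J, IsRangeFunction V J) :
    IsRangeFunction V (rangeFunction V) := by
  rw [rangeFunction, dif_pos h]
  exact h.choose_spec

/-- Projecting the basis vectors of `ℓ²` onto `J x` gives countably many fields that are fibers of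
elements of `V`, hence lie in `J' x` almost everywhere; together they determine `J x`. Symmetry
yields uniqueness of the range function. -/
theorem IsRangeFunction.ae_le {V : Submodule ℂ (L2R k)}
    {J J' : EuclideanSpace ℝ (Fin k) → ClosedSubmodule ℂ (Ell2 (Fin k → ℤ))}
    (hJ : IsRangeFunction V J) (hJ' : IsRangeFunction V J') :
    ∀ᵐ x ∂torusMeasure k, (J x).toSubmodule ≤ (J' x).toSubmodule := by
  classical
  have hz : ∀ ℓ : Fin k → ℤ, MemLp (fun x => (J x).toSubmodule.starProjection
      (lp.single 2 ℓ (1 : ℂ) : Ell2 (Fin k → ℤ))) 2 (torusMeasure k) := by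
    intro ℓ
    refine MemLp.of_bound (aestronglyMeasurable_of_coord fun m => ?_)
      ‖(lp.single 2 ℓ (1 : ℂ) : Ell2 (Fin k → ℤ))‖
      (Filter.Eventually.of_forall fun x => (J x).toSubmodule.norm_starProjection_apply_le _)
    have h := hJ.measurable (lp.single 2 ℓ (1 : ℂ)) (lp.single 2 m (1 : ℂ))
    simpa [lp.inner_single_left] using h.aestronglyMeasurable
  choose f hf using fun ℓ => exists_fiberization_eq (hz ℓ)
  have hfV : ∀ ℓ, f ℓ ∈ V := fun ℓ => by
    rw [hJ.mem_iff]
    filter_upwards [hf ℓ] with x hx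
    rw [hx]
    exact Submodule.starProjection_apply_mem _ _
  have h1 := ae_all_iff.mpr fun ℓ => (hJ'.mem_iff (f ℓ)).mp (hfV ℓ)
  filter_upwards [h1, ae_all_iff.mpr hf] with x hx hx'
  have h2 : (J' x).toSubmodule.starProjection ∘L (J x).toSubmodule.starProjection =
      (J x).toSubmodule.starProjection := by
    refine ext_on_single fun ℓ => ?_
    rw [ContinuousLinearMap.comp_apply, Submodule.starProjection_eq_self_iff, ← hx' ℓ]
    exact hx ℓ
  intro v hv
  have h3 := congrArg (fun T : Ell2 (Fin k → ℤ) →L[ℂ] Ell2 (Fin k → ℤ) => T v) h2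
  simp only [ContinuousLinearMap.comp_apply] at h3
  rw [(Submodule.starProjection_eq_self_iff (K := (J x).toSubmodule)).mpr hv] at h3
  exact Submodule.starProjection_eq_self_iff.mp h3

/-- The span of the fibers of a finite family. -/
noncomputable def fiberSpan (G : Fin n → L2R k) (x : EuclideanSpace ℝ (Fin k)) :
    ClosedSubmodule ℂ (Ell2 (Fin k → ℤ)) where
  toSubmodule := Submodule.span ℂ (Set.range fun i => fiberization (G i) x)
  isClosed' :=
    haveI := FiniteDimensional.span_of_finite ℂ (Set.finite_range fun i => fiberization (G i) x)
    Submodule.closed_of_finiteDimensional _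

/-- On fibers, `T_R T_G^* = id` on `V` says that the mixed field maps into the span of the `Γ Rᵢ x`
and fixes it almost everywhere, which gives the membership criterion. -/
theorem isRangeFunction_fiberSpan {V : Submodule ℂ (L2R k)} (hV : IsFSI V) {G R : Fin n → L2R k}
    (hG : IsBessel (translates G)) (hR : IsBessel (translates R)) (hRV : ∀ i, R i ∈ V)
    (hGR : ∀ v ∈ V, synthesisOp (translates R) (analysisOp (translates G) v) = v) :
    IsRangeFunction V (fiberSpan R) := by
  have : CompleteSpace V := hV.isClosed.completeSpace_coe
  have hRV' : ∀ p, translates R p ∈ V := fun p => hV.shiftBy_mem _ (hRV _)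
  have hfix : ∀ᵐ x ∂torusMeasure k, ∀ j,
      mixedField G R x (fiberization (R j) x) = fiberization (R j) x := by
    refine ae_all_iff.mpr fun j => ?_
    filter_upwards [(isFiberField_mixedField hG hR).intertwines (R j)] with x hx
    rw [hx, ContinuousLinearMap.comp_apply, hGR _ (hRV j)]
  have hspan : ∀ (G : Fin n → L2R k) x v, mixedField G R x v ∈ (fiberSpan R x).toSubmodule := by
    intro G x v
    rw [mixedField_apply]
    exact Submodule.sum_mem _ fun i _ => Submodule.smul_mem _ _ (Submodule.subset_span ⟨i, rfl⟩)
  have hfix_span : ∀ {T : Ell2 (Fin k → ℤ) →L[ℂ] Ell2 (Fin k → ℤ)} {x},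
      (∀ j, T (fiberization (R j) x) = fiberization (R j) x) →
      ∀ v ∈ (fiberSpan R x).toSubmodule, T v = v := by
    intro T x h v hv
    have : (fiberSpan R x).toSubmodule ≤
        LinearMap.eqLocus (T : Ell2 (Fin k → ℤ) →ₗ[ℂ] Ell2 (Fin k → ℤ)) LinearMap.id := by
      refine Submodule.span_le.mpr ?_
      rintro _ ⟨j, rfl⟩
      exact h j
    exact this hv
  constructor
  -- For measurability, replacing `G` by `q G` turns the mixed operator into `q` itself. Its field
  -- is then self-adjoint, has values in the span and fixes it, so it is the orthogonal projection
  -- onto the span, and mixed fields are measurable.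
  · set q := V.starProjection with hq
    have hqs : IsShiftPreserving q := isShiftPreserving_starProjection hV
    have hqG := isBessel_translates_map hqs hG
    have hq1 : synthesisOp (translates R) ∘L analysisOp (translates fun i => q (G i)) = q := by
      ext1 u
      rw [translates_map hqs, analysisOp_map hG]
      have hqa : ContinuousLinearMap.adjoint q = q := isSelfAdjoint_starProjection V
      rw [hqa]
      exact hGR _ (V.starProjection_apply_mem u)
    have hq2 : synthesisOp (translates fun i => q (G i)) ∘L analysisOp (translates R) = q := by
      rw [← adjoint_synthesisOp_comp_analysisOp, hq1]
      exact isSelfAdjoint_starProjection V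
    have hf1 := isFiberField_mixedField hqG hR
    have hf2 := isFiberField_mixedField hR hqG
    rw [hq1] at hf1
    rw [hq2] at hf2
    have hsym := (fiberField_ae_eq hf1).symm.trans (fiberField_ae_eq hf2)
    have hfixq : ∀ᵐ x ∂torusMeasure k, ∀ j,
        mixedField (fun i => q (G i)) R x (fiberization (R j) x) = fiberization (R j) x := by
      refine ae_all_iff.mpr fun j => ?_
      filter_upwards [hf1.intertwines (R j)] with x hx
      rw [hx, hq, Submodule.starProjection_eq_self_iff.mpr (hRV j)]
    intro ξ η
    refine (hf1.measurable ξ η).congr ?_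
    filter_upwards [hsym, hfixq] with x h1 h2
    congr 1
    refine (Submodule.eq_starProjection_of_mem_of_inner_eq_zero (hspan _ x ξ) fun w hw => ?_).symm
    rw [inner_sub_left, inner_mixedField, ← h1, hfix_span h2 w hw, sub_self]
  · intro f
    constructor
    · intro hf
      filter_upwards [(isFiberField_mixedField hG hR).intertwines f] with x hx
      rw [ContinuousLinearMap.comp_apply, hGR f hf] at hx
      rw [← hx]
      exact hspan G x _
    · intro hf
      have : synthesisOp (translates R) (analysisOp (translates G) f) = f := by
        refine eq_of_fiberization_ae_eq ?_
        filter_upwards [(isFiberField_mixedField hG hR).intertwines f, hf, hfix] with x h1 h2 h3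
        rw [← ContinuousLinearMap.comp_apply, ← h1]
        exact hfix_span h3 _ h2
      rw [← this]
      exact synthesisOp_mem hV.isClosed hR hRV' _

theorem rangeFunction_ae_eq {V : Submodule ℂ (L2R k)}
    {J : EuclideanSpace ℝ (Fin k) → ClosedSubmodule ℂ (Ell2 (Fin k → ℤ))}
    (hJ : IsRangeFunction V J) :
    ∀ᵐ x ∂torusMeasure k, (rangeFunction V x).toSubmodule = (J x).toSubmodule := by
  have hs := rangeFunction_spec ⟨J, hJ⟩
  filter_upwards [hs.ae_le hJ, hJ.ae_le hs] with x h1 h2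
  exact le_antisymm h1 h2

end Fields

/-! ### Rank bounds from linear algebra -/

section RankBounds

variable {n : ℕ} {E : Type} [AddCommGroup E] [Module ℂ E]

/-- If a matrix `c` reproduces `φ` and annihilates `r`, the ranks of `φ` and `r` add up to at most
their length. -/
theorem finrank_span_add_finrank_span_le {φ r : Fin n → E} (c : Fin n → Fin n → ℂ)
    (hφ : ∀ j, ∑ i, c j i • φ i = φ j) (hr : ∀ j, ∑ i, c j i • r i = 0) :
    Module.finrank ℂ (Submodule.span ℂ (Set.range φ)) +
      Module.finrank ℂ (Submodule.span ℂ (Set.range r)) ≤ n := by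
  set Φ := Fintype.linearCombination ℂ φ
  set R := Fintype.linearCombination ℂ r with hR
  -- Row `j` of `c` is a relation among the `r i` that `Φ` sends to `φ j`; rank-nullity for `R`
  -- finishes the count.
  have h1 : Submodule.span ℂ (Set.range φ) ≤ R.ker.map Φ := by
    refine Submodule.span_le.mpr ?_
    rintro _ ⟨j, rfl⟩
    exact ⟨c j, by simpa [R, Fintype.linearCombination_apply] using hr j,
      by simpa [Φ, Fintype.linearCombination_apply] using hφ j⟩
  have h2 : Module.finrank ℂ (Submodule.span ℂ (Set.range φ)) ≤ Module.finrank ℂ R.ker :=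
    (Submodule.finrank_mono h1).trans (Submodule.finrank_map_le _ _)
  have h3 := R.finrank_range_add_finrank_ker
  rw [hR, Fintype.range_linearCombination, ← hR] at h3
  simp only [Module.finrank_fintype_fun_eq_card, Fintype.card_fin] at h3
  omega

/-- A matrix that factors through a linear map has at most the rank of the latter. -/
theorem matrix_rank_le_of_factor {E' : Type} [AddCommGroup E'] [Module ℂ E']
    {A : Matrix (Fin n) (Fin n) ℂ} (s : E →ₗ[ℂ] E') (f : (Fin n → ℂ) →ₗ[ℂ] E)
    (g : E' →ₗ[ℂ] (Fin n → ℂ)) (h : A.mulVecLin = g ∘ₗ s ∘ₗ f) :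
    (A.rank : Cardinal) ≤ s.rank := by
  have h1 : (A.rank : Cardinal) = A.mulVecLin.rank := by
    rw [Matrix.rank, LinearMap.rank, Module.finrank_eq_rank]
  rw [h1, h]
  exact (LinearMap.rank_comp_le_right _ _).trans (LinearMap.rank_comp_le_left _ _)

end RankBounds

/-! ### The two inclusions for shift-generated duals -/

section Main

variable {k n : ℕ} {V W : Submodule ℂ (L2R k)} {F : Fin n → L2R k}

/-- The generators of the canonical oblique dual of `E(F)`. -/
noncomputable abbrev dualGen (V W : Submodule ℂ (L2R k)) (hVW : IsCompl V Wᗮ) (F : Fin n → L2R k) :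
    Fin n → L2R k := fun i => canonicalObliqueDual V W hVW (translates F) (0, i)

variable [W.HasOrthogonalProjection]

theorem isShiftPreserving_moorePenrose (hF : IsFrameFor W (translates F)) :
    IsShiftPreserving (moorePenrose (frameOp (translates F))) :=
  (isShiftPreserving_frameOp hF.isBessel).moorePenrose (moorePenrose_frameOp hF).1

theorem canonicalObliqueDual_eq_translates (hV : IsFSI V) (hW : IsFSI W) (hVW : IsCompl V Wᗮ)
    (hF : IsFrameFor W (translates F)) :
    canonicalObliqueDual V W hVW (translates F) = translates (dualGen V W hVW F) := by
  have hT := (isShiftPreserving_obliqueProj hV hW hVW).mul (isShiftPreserving_moorePenrose hF)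
  have h : dualGen V W hVW F =
      fun i => (obliqueProj V W hV.isClosed hVW * moorePenrose (frameOp (translates F))) (F i) := by
    ext1 i
    rw [dualGen, canonicalObliqueDual_eq hV.isClosed]
    exact congrArg _ (translates_zero_apply F i)
  rw [h, canonicalObliqueDual_eq hV.isClosed]
  exact (translates_map hT F).symm

/-- The fiberwise facts about a frame `E(F)` of `W` and its canonical oblique dual `E(φ)`. -/
theorem exists_dualGen (hV : IsFSI V) (hW : IsFSI W) (hVW : IsCompl V Wᗮ)
    (hF : IsFrameFor W (translates F)) :
    IsBessel (translates (dualGen V W hVW F)) ∧ (∀ i, dualGen V W hVW F i ∈ V) ∧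
      synthesisOp (translates (dualGen V W hVW F)) ∘L analysisOp (translates F) =
        obliqueProj V W hV.isClosed hVW := by
  rw [← canonicalObliqueDual_eq_translates hV hW hVW hF]
  exact ⟨canonicalObliqueDual_isBessel hV.isClosed hVW hF,
    fun i => canonicalObliqueDual_mem hV.isClosed hVW _,
    synthesisOp_canonicalObliqueDual_comp hV.isClosed hVW hF⟩

theorem rangeFunction_eq_fiberSpan (hV : IsFSI V) (hW : IsFSI W) (hVW : IsCompl V Wᗮ)
    (hF : IsFrameFor W (translates F)) : IsRangeFunction V (fiberSpan (dualGen V W hVW F)) := by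
  obtain ⟨h1, h2, h3⟩ := exists_dualGen hV hW hVW hF
  refine isRangeFunction_fiberSpan hV hF.isBessel h1 h2 fun v hv => ?_
  rw [← ContinuousLinearMap.comp_apply, h3, obliqueProj_of_mem hV.isClosed hVW hv]

/-- The frame operator of a perturbation `R` of the canonical dual satisfies the rank bound. -/
theorem rank_frameOp_add_rank_le (hV : IsFSI V) (hW : IsFSI W) (hVW : IsCompl V Wᗮ)
    (hF : IsFrameFor W (translates F)) {R : Fin n → L2R k} (hR : IsBessel (translates R))
    (hRF : synthesisOp (translates R) ∘L analysisOp (translates F) = 0) :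
    ∀ᵐ x ∂torusMeasure k,
      (fiberField (frameOp (translates R)) x :
          Ell2 (Fin k → ℤ) →ₗ[ℂ] Ell2 (Fin k → ℤ)).rank +
        Module.rank ℂ (rangeFunction V x).toSubmodule ≤ (n : Cardinal) := by
  obtain ⟨h1, h2, h3⟩ := exists_dualGen hV hW hVW hF
  set φ := dualGen V W hVW F with hφ
  have hs := isFiberField_mixedField hR hR
  rw [← frameOp_eq] at hs
  -- Evaluating `T_φ T_F^* = P` and `T_R T_F^* = 0` at each `φ j` provides the matrix required by
  -- `finrank_span_add_finrank_span_le`.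
  have e1 : ∀ᵐ x ∂torusMeasure k, ∀ j,
      ∑ i, ⟪fiberization (F i) x, fiberization (φ j) x⟫_ℂ • fiberization (φ i) x =
        fiberization (φ j) x := by
    refine ae_all_iff.mpr fun j => ?_
    filter_upwards [fiberization_synthesisOp_analysisOp hF.isBessel h1 (φ j)] with x hx
    rw [← hx, ← ContinuousLinearMap.comp_apply, h3, obliqueProj_of_mem hV.isClosed hVW (h2 j)]
  have e2 : ∀ᵐ x ∂torusMeasure k, ∀ j,
      ∑ i, ⟪fiberization (F i) x, fiberization (φ j) x⟫_ℂ • fiberization (R i) x = 0 := by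
    refine ae_all_iff.mpr fun j => ?_
    filter_upwards [fiberization_synthesisOp_analysisOp hF.isBessel hR (φ j),
      fiberization_zero (k := k)] with x hx h0
    rw [← hx, ← ContinuousLinearMap.comp_apply, hRF, ← h0]
    rfl
  filter_upwards [fiberField_ae_eq hs, rangeFunction_ae_eq (rangeFunction_eq_fiberSpan hV hW hVW hF),
    e1, e2] with x hx1 hx2 hx3 hx4
  rw [hx1, hx2]
  have key := finrank_span_add_finrank_span_le _ hx3 hx4
  have fφ := FiniteDimensional.span_of_finite ℂ (Set.finite_range fun i => fiberization (φ i) x)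
  have fR := FiniteDimensional.span_of_finite ℂ (Set.finite_range fun i => fiberization (R i) x)
  have hle : LinearMap.range (mixedField R R x : Ell2 (Fin k → ℤ) →ₗ[ℂ] Ell2 (Fin k → ℤ)) ≤
      Submodule.span ℂ (Set.range fun i => fiberization (R i) x) := by
    rintro _ ⟨v, rfl⟩
    rw [ContinuousLinearMap.coe_coe, mixedField_apply]
    exact Submodule.sum_mem _ fun i _ => Submodule.smul_mem _ _ (Submodule.subset_span ⟨i, rfl⟩)
  have hr : (mixedField R R x : Ell2 (Fin k → ℤ) →ₗ[ℂ] Ell2 (Fin k → ℤ)).rank ≤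
      (Module.finrank ℂ (Submodule.span ℂ (Set.range fun i => fiberization (R i) x)) : Cardinal) := by
    rw [Module.finrank_eq_rank]
    exact Submodule.rank_mono hle
  have hd : Module.rank ℂ (fiberSpan φ x).toSubmodule =
      (Module.finrank ℂ (Submodule.span ℂ (Set.range fun i => fiberization (φ i) x)) : Cardinal) :=
    (Module.finrank_eq_rank ℂ (Submodule.span ℂ (Set.range fun i => fiberization (φ i) x))).symm
  rw [hd]
  refine (add_le_add_left hr _).trans ?_
  rw [← Nat.cast_add, add_comm]
  exact_mod_cast key

/-- The difference `R = G - φ` of two duals satisfies `T_R T_F^* = P - P = 0`, and `B = S_R` is the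
required perturbation. -/
theorem image_frameOp_subset (hV : IsFSI V) (hW : IsFSI W) (hVW : IsCompl V Wᗮ)
    (hF : IsFrameFor W (translates F)) :
    frameOp '' shiftGeneratedDuals V W F ⊆
      additiveModel V (canonicalObliqueDual V W hVW (translates F)) := by
  rintro _ ⟨_, ⟨hg, G, hGV, rfl⟩, rfl⟩
  obtain ⟨h1, h2, h3⟩ := exists_dualGen hV hW hVW hF
  obtain ⟨-, hG, hGF⟩ := (mem_obliqueDuals_iff hV.isClosed hVW hF _).mp hg
  have hcd := canonicalObliqueDual_eq_translates hV hW hVW hF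
  set φ := dualGen V W hVW F with hφ
  set R : Fin n → L2R k := fun i => G i - φ i with hRdef
  have hRt : ∀ p, translates R p = translates G p - translates φ p := fun p => shiftBy_sub _ _ _
  have hR : IsBessel (translates R) := by
    rw [funext hRt]
    exact hG.sub h1
  have hGsum : translates G = fun p => translates φ p + translates R p := by
    ext1 p
    rw [hRt, add_sub_cancel]
  have hRV : ∀ i, R i ∈ V := fun i => V.sub_mem (hGV i) (h2 i)
  have hRF : synthesisOp (translates R) ∘L analysisOp (translates F) = 0 := by
    rw [hGsum, synthesisOp_add h1 hR, ContinuousLinearMap.add_comp, h3] at hGF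
    simpa using hGF
  refine ⟨frameOp (translates R), frameOp_isPositive _, isShiftPreserving_frameOp hR, fun f => ?_,
    rank_frameOp_add_rank_le hV hW hVW hF hR hRF, ?_⟩
  · rw [frameOp_eq]
    exact synthesisOp_mem hV.isClosed hR (fun p => hV.shiftBy_mem _ (hRV _)) _
  · have := frameOp_canonicalObliqueDual_add hV.isClosed hVW hF hR hRF
    rw [← this, hcd, hGsum]


theorem hasBoundedFibers_map {T : L2R k →L[ℂ] L2R k} (hT : IsShiftPreserving T)
    (hF : IsBessel (translates F)) (i : Fin n) : HasBoundedFibers (T (F i)) :=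
  hasBoundedFibers_of_isBessel (isBessel_translates_map hT hF) i

open Matrix in
open scoped ComplexOrder in
/-- Given `B ≥ 0` with range in `V` and the rank bound, `B` is the frame operator of a shift
generated family in `V` that is orthogonal to `E(F)`. -/
theorem exists_frameOp_eq (hV : IsFSI V) (hW : IsFSI W) (hVW : IsCompl V Wᗮ)
    (hF : IsFrameFor W (translates F)) {B : L2R k →L[ℂ] L2R k} (hB : B.IsPositive)
    (hBs : IsShiftPreserving B) (hBV : ∀ f, B f ∈ V)
    (hrank : ∀ᵐ x ∂torusMeasure k,
      (fiberField B x : Ell2 (Fin k → ℤ) →ₗ[ℂ] Ell2 (Fin k → ℤ)).rank +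
        Module.rank ℂ (rangeFunction V x).toSubmodule ≤ (n : Cardinal)) :
    ∃ R : Fin n → L2R k, (∀ i, R i ∈ V) ∧ IsBessel (translates R) ∧
      synthesisOp (translates R) ∘L analysisOp (translates F) = 0 ∧
      frameOp (translates R) = B := by
  obtain ⟨h1, h2, h3⟩ := exists_dualGen hV hW hVW hF
  have hFb := hF.isBessel
  have hJ := rangeFunction_eq_fiberSpan hV hW hVW hF
  have hXs := isShiftPreserving_moorePenrose hF
  have hXa : IsSelfAdjoint (moorePenrose (frameOp (translates F))) := (moorePenrose_frameOp hF).2.1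
  have hFW : ∀ i, F i ∈ W := fun i => by rw [← translates_zero_apply F i]; exact hF.1 _
  have hφX : ∀ i, dualGen V W hVW F i =
      obliqueProj V W hV.isClosed hVW (moorePenrose (frameOp (translates F)) (F i)) := fun i => by
    rw [dualGen, canonicalObliqueDual_eq hV.isClosed, ← mul_apply_eq_comp]
    exact congrArg _ (translates_zero_apply F i)
  set φ := dualGen V W hVW F with hφ
  set X := moorePenrose (frameOp (translates F)) with hX
  set P := obliqueProj V W hV.isClosed hVW with hP
  have hφb := isBessel_translates_iff.mp h1
  have hFbd := isBessel_translates_iff.mp hFb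
  have hinnerP : ∀ i (ℓ : Fin k → ℤ) (u : L2R k),
      ⟪shiftBy ℓ (F i), P u⟫_ℂ = ⟪shiftBy ℓ (F i), u⟫_ℂ := fun i ℓ u =>
    inner_obliqueProj hV.isClosed hVW (hW.shiftBy_mem ℓ (hFW i)) u
  have hBa : ContinuousLinearMap.adjoint B = B := hB.isSelfAdjoint
  have hPB : P ∘L B = B := by
    ext1 u
    exact obliqueProj_of_mem hV.isClosed hVW (hBV u)
  have hBF := isBessel_translates_map hBs hFb
  -- the field of `B`
  have hBmix : synthesisOp (translates fun i => B (F i)) ∘L analysisOp (translates φ) = B := by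
    have e := congrArg ContinuousLinearMap.adjoint hPB
    rw [ContinuousLinearMap.adjoint_comp, hBa, ← h3, adjoint_synthesisOp_comp_analysisOp] at e
    rw [translates_map hBs, synthesisOp_map hFb]
    exact e
  have hBfield := isFiberField_mixedField h1 hBF
  rw [hBmix] at hBfield
  have hBf := fiberField_spec ⟨_, hBfield⟩
  -- matrices
  set β : EuclideanSpace ℝ (Fin k) → Matrix (Fin n) (Fin n) ℂ := fun x =>
    of fun i j => ⟪fiberization (F i) x, fiberization (B (F j)) x⟫_ℂ with hβ
  set M : EuclideanSpace ℝ (Fin k) → Matrix (Fin n) (Fin n) ℂ := fun x =>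
    of fun i j => ⟪fiberization (F i) x, fiberization (φ j) x⟫_ℂ with hM
  have hβm : ∀ i j, AEMeasurable (fun x => β x i j) (torusMeasure k) := fun i j =>
    ((aestronglyMeasurable_fiberization (F i)).inner
      (aestronglyMeasurable_fiberization (B (F j)))).aemeasurable
  have hMm : ∀ i j, AEMeasurable (fun x => (1 - M x) i j) (torusMeasure k) := fun i j =>
    aemeasurable_const.sub ((aestronglyMeasurable_fiberization (F i)).inner
      (aestronglyMeasurable_fiberization (φ j))).aemeasurable
  -- With `D` the square root of `B`, `β x` is the Gram matrix of the fibers of the `D (F i)`.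
  have hβpsd : ∀ᵐ x ∂torusMeasure k, (β x).PosSemidef := by
    obtain ⟨D, hDa, hDD, hDc⟩ := hB.exists_sqrt
    have hDs : IsShiftPreserving D :=
      isShiftPreserving_iff.mpr fun ℓ => hDc _ (isShiftPreserving_iff.mp hBs ℓ)
    have hDa' : ContinuousLinearMap.adjoint D = D := hDa
    have : ∀ᵐ x ∂torusMeasure k, ∀ i j, β x i j =
        ⟪fiberization (D (F i)) x, fiberization (D (F j)) x⟫_ℂ := by
      refine ae_all_iff.mpr fun i => ae_all_iff.mpr fun j => ?_
      refine inner_fiberization_eq (hFbd i) (hasBoundedFibers_map hDs hFb i) fun ℓ => ?_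
      rw [hDs ℓ, ← hDD, ← ContinuousLinearMap.adjoint_inner_right, hDa']
      rfl
    filter_upwards [this] with x hx
    have : β x = gram ℂ fun i => fiberization (D (F i)) x := by
      ext i j
      rw [hx, gram_apply]
    rw [this]
    exact posSemidef_gram ℂ _
  -- Since `F i ∈ W`, the projection in `φ j = P X (F j)` is invisible to `M`, which becomes a
  -- matrix of the self-adjoint operator `X`.
  have hMherm : ∀ᵐ x ∂torusMeasure k, (M x)ᴴ = M x := by
    have e1 : ∀ᵐ x ∂torusMeasure k, ∀ i j, M x i j =
        ⟪fiberization (X (F i)) x, fiberization (F j) x⟫_ℂ := by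
      refine ae_all_iff.mpr fun i => ae_all_iff.mpr fun j => ?_
      refine inner_fiberization_eq (hFbd i) (hasBoundedFibers_map hXs hFb i) fun ℓ => ?_
      rw [hφX, hinnerP, hXs ℓ, ← ContinuousLinearMap.adjoint_inner_left]
      rw [show ContinuousLinearMap.adjoint X = X from hXa]
    have e2 : ∀ᵐ x ∂torusMeasure k, ∀ i j, M x i j =
        ⟪fiberization (F i) x, fiberization (X (F j)) x⟫_ℂ := by
      refine ae_all_iff.mpr fun i => ae_all_iff.mpr fun j => ?_
      refine inner_fiberization_eq (hFbd i) (hFbd i) fun ℓ => ?_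
      rw [hφX, hinnerP]
    filter_upwards [e1, e2] with x hx hx'
    ext i j
    rw [conjTranspose_apply, hx j i, hx' i j]
    exact inner_conj_symm _ _
  -- `M` reproduces the analysis coefficients
  have hMa : ∀ u : L2R k, ∀ᵐ x ∂torusMeasure k,
      (M x) *ᵥ (fun j => ⟪fiberization (F j) x, fiberization u x⟫_ℂ) =
        fun i => ⟪fiberization (F i) x, fiberization u x⟫_ℂ := by
    intro u
    have e1 : ∀ᵐ x ∂torusMeasure k, ∀ i, ⟪fiberization (F i) x, fiberization (P u) x⟫_ℂ =
        ⟪fiberization (F i) x, fiberization u x⟫_ℂ :=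
      ae_all_iff.mpr fun i => inner_fiberization_eq (hFbd i) (hFbd i) fun ℓ => hinnerP i ℓ u
    filter_upwards [e1, fiberization_synthesisOp_analysisOp hFb h1 u] with x hx hx'
    ext i
    rw [← hx i, ← h3, ContinuousLinearMap.comp_apply, hx', inner_sum]
    simp only [mulVec, dotProduct, inner_smul_right, hM, of_apply]
    exact Finset.sum_congr rfl fun j _ => mul_comm _ _
  have hMM : ∀ᵐ x ∂torusMeasure k, M x * M x = M x := by
    filter_upwards [ae_all_iff.mpr fun l => hMa (φ l)] with x hx
    ext i l
    exact congrFun (hx l) i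
  have hQ : ∀ᵐ x ∂torusMeasure k, (1 - M x).PosSemidef ∧ (1 - M x) * (1 - M x) = 1 - M x := by
    filter_upwards [hMherm, hMM] with x hx hx'
    have e1 : (1 - M x) * (1 - M x) = 1 - M x := by
      rw [mul_sub, sub_mul, sub_mul, hx']
      simp
    refine ⟨?_, e1⟩
    have e2 := posSemidef_conjTranspose_mul_self (1 - M x)
    rwa [conjTranspose_sub, conjTranspose_one, hx, e1] at e2
  -- `β` factors through `[B]_x` and `M` through `J_V(x)`, so their ranks add up to at most `n`,
  -- while subadditivity gives `n ≤ rank (1 - M) + rank M`.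
  have hrk : ∀ᵐ x ∂torusMeasure k, (β x).rank ≤ (1 - M x).rank := by
    filter_upwards [hrank, rangeFunction_ae_eq hJ,
      ae_all_iff.mpr fun j => hBf.intertwines (F j)] with x hx1 hx2 hx3
    set a : Ell2 (Fin k → ℤ) →ₗ[ℂ] (Fin n → ℂ) :=
      LinearMap.pi fun i => (innerSL ℂ (fiberization (F i) x)).toLinearMap with ha
    have e1 : ((β x).rank : Cardinal) ≤
        (fiberField B x : Ell2 (Fin k → ℤ) →ₗ[ℂ] Ell2 (Fin k → ℤ)).rank := by
      refine matrix_rank_le_of_factor _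
        (Fintype.linearCombination ℂ fun j => fiberization (F j) x) a ?_
      refine LinearMap.pi_ext' fun j => LinearMap.ext_ring ?_
      ext i
      simp [a, Fintype.linearCombination_apply_single, hx3, hβ]
    have e2 : ((M x).rank : Cardinal) ≤
        Module.rank ℂ (rangeFunction V x).toSubmodule := by
      rw [hx2]
      have e3 := matrix_rank_le_of_factor (A := M x)
        (Fintype.linearCombination ℂ fun j => fiberization (φ j) x) LinearMap.id a (by
          refine LinearMap.pi_ext' fun j => LinearMap.ext_ring ?_
          ext i
          simp [a, Fintype.linearCombination_apply_single, hM])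
      refine e3.trans_eq ?_
      rw [LinearMap.rank, Fintype.range_linearCombination]
      rfl
    have e4 : (β x).rank + (M x).rank ≤ n := by
      have := (add_le_add e1 e2).trans hx1
      exact_mod_cast this
    have e5 : n ≤ (1 - M x).rank + (M x).rank := by
      have := matrix_rank_add_le (1 - M x) (M x)
      rwa [sub_add_cancel, rank_one, Fintype.card_fin] at this
    omega
  -- the measurable factorization
  set β' : EuclideanSpace ℝ (Fin k) → Matrix (Fin n) (Fin n) ℂ := fun x =>
    of fun i j => (hβm i j).mk _ x with hβ'
  set Q' : EuclideanSpace ℝ (Fin k) → Matrix (Fin n) (Fin n) ℂ := fun x =>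
    of fun i j => (hMm i j).mk _ x with hQ'
  have hββ' : ∀ᵐ x ∂torusMeasure k, β x = β' x := by
    filter_upwards [ae_all_iff.mpr fun i => ae_all_iff.mpr fun j => (hβm i j).ae_eq_mk] with x hx
    ext i j
    exact hx i j
  have hQQ' : ∀ᵐ x ∂torusMeasure k, 1 - M x = Q' x := by
    filter_upwards [ae_all_iff.mpr fun i => ae_all_iff.mpr fun j => (hMm i j).ae_eq_mk] with x hx
    ext i j
    exact hx i j
  -- `n` pivots suffice because an `n × n` matrix has rank at most `n`.
  set C : EuclideanSpace ℝ (Fin k) → Matrix (Fin n) (Fin n) ℂ := fun x =>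
    pivotFactor n (β' x) (Q' x) with hC
  have hCm : ∀ i j, Measurable fun x => C x i j :=
    measurable_pivotFactor n (fun i j => (hβm i j).measurable_mk)
      (fun i j => (hMm i j).measurable_mk)
  have hCspec : ∀ᵐ x ∂torusMeasure k, C x * (C x)ᴴ = β x ∧ C x * (1 - M x) = C x := by
    filter_upwards [hββ', hQQ', hβpsd, hQ, hrk] with x e1 e2 e3 e4 e5
    rw [hC, e2, e1]
    rw [e1] at e3 e5
    rw [e2] at e4 e5
    exact pivotFactor_spec n e3 e4.1 e4.2
      ((rank_le_card_width _).trans_eq (Fintype.card_fin n)) e5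
  -- The squared norm of row `i` of `C` is the diagonal entry `βᵢᵢ`, bounded because `F i` and `B (F
  -- i)` have bounded fibers.
  obtain ⟨K, hK⟩ : ∃ K : ℝ, ∀ᵐ x ∂torusMeasure k, ∀ i j, ‖C x i j‖ ≤ K := by
    choose c hc using hFbd
    choose d hd using fun i => hasBoundedFibers_map hBs hFb i
    refine ⟨Real.sqrt (∑ i, c i * d i), ?_⟩
    filter_upwards [hCspec, ae_all_iff.mpr hc, ae_all_iff.mpr hd] with x e1 e2 e3 i j
    refine Real.le_sqrt_of_sq_le ?_
    have e4 : ((∑ l, ‖C x i l‖ ^ 2 : ℝ) : ℂ) = β x i i := by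
      rw [← e1.1, mul_apply]
      push_cast
      refine Finset.sum_congr rfl fun l _ => ?_
      rw [conjTranspose_apply]
      exact (Complex.mul_conj' _).symm
    have e5 : ∑ l, ‖C x i l‖ ^ 2 ≤ c i * d i := by
      have e6 : ∑ l, ‖C x i l‖ ^ 2 = ‖β x i i‖ := by
        rw [← e4, Complex.norm_real, Real.norm_of_nonneg (by positivity)]
      rw [e6]
      exact (norm_inner_le_norm _ _).trans
        (mul_le_mul (e2 i) (e3 i) (norm_nonneg _) ((norm_nonneg _).trans (e2 i)))
    have e7 : ∀ i, 0 ≤ c i * d i := fun i =>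
      mul_nonneg ((norm_nonneg _).trans (e2 i)) ((norm_nonneg _).trans (e3 i))
    calc ‖C x i j‖ ^ 2 ≤ ∑ l, ‖C x i l‖ ^ 2 :=
          Finset.single_le_sum (f := fun l => ‖C x i l‖ ^ 2) (fun l _ => by positivity)
            (Finset.mem_univ j)
      _ ≤ c i * d i := e5
      _ ≤ _ := Finset.single_le_sum (f := fun i => c i * d i) (fun i _ => e7 i) (Finset.mem_univ i)
  set z : Fin n → EuclideanSpace ℝ (Fin k) → Ell2 (Fin k → ℤ) := fun j x =>
    ∑ i, C x i j • fiberization (φ i) x with hz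
  obtain ⟨L, hL⟩ : ∃ L : ℝ, ∀ᵐ x ∂torusMeasure k, ∀ j, ‖z j x‖ ≤ L := by
    choose c hc using hφb
    refine ⟨∑ i, K * c i, ?_⟩
    filter_upwards [hK, ae_all_iff.mpr hc] with x e1 e2 j
    refine (norm_sum_le _ _).trans (Finset.sum_le_sum fun i _ => ?_)
    rw [norm_smul]
    exact mul_le_mul (e1 i j) (e2 i) (norm_nonneg _) ((norm_nonneg _).trans (e1 i j))
  have hzL : ∀ j, MemLp (z j) 2 (torusMeasure k) := fun j => by
    refine MemLp.of_bound ?_ L (hL.mono fun x hx => hx j)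
    exact Finset.aestronglyMeasurable_fun_sum _ fun i _ =>
      (hCm i j).aestronglyMeasurable.smul (aestronglyMeasurable_fiberization (φ i))
  choose R hRz using fun j => exists_fiberization_eq (hzL j)
  have hRz' := ae_all_iff.mpr hRz
  have hRb : IsBessel (translates R) := isBessel_translates fun j => ⟨L, by
    filter_upwards [hRz j, hL] with x e1 e2
    rw [e1]
    exact e2 j⟩
  refine ⟨R, fun j => ?_, hRb, ?_, ?_⟩
  · rw [hJ.mem_iff]
    filter_upwards [hRz j] with x hx
    rw [hx]
    exact Submodule.sum_mem _ fun i _ => Submodule.smul_mem _ _ (Submodule.subset_span ⟨i, rfl⟩)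
  · ext1 u
    refine eq_of_fiberization_ae_eq ?_
    filter_upwards [fiberization_synthesisOp_analysisOp hFb hRb u, hRz', hCspec, hMa u,
      fiberization_zero (k := k)] with x e1 e2 e3 e4 e5
    rw [ContinuousLinearMap.comp_apply, e1, _root_.zero_apply, e5]
    simp only [e2, hz, Finset.smul_sum]
    rw [Finset.sum_comm]
    refine Finset.sum_eq_zero fun i _ => ?_
    simp only [smul_smul]
    rw [← Finset.sum_smul]
    -- `M` fixes the analysis coefficients of `u`, and `C = C (1 - M)` therefore kills them.
    have e6 : C x *ᵥ (fun j => ⟪fiberization (F j) x, fiberization u x⟫_ℂ) = 0 := by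
      rw [← e3.2, ← mulVec_mulVec, sub_mulVec, e4, one_mulVec, sub_self, mulVec_zero]
    have e7 := congrFun e6 i
    simp only [mulVec, dotProduct, Pi.zero_apply] at e7
    rw [Finset.sum_congr rfl fun j _ => mul_comm _ _, e7, zero_smul]
  · ext1 u
    refine eq_of_fiberization_ae_eq ?_
    -- Both sides become `∑ᵢₗ βᵢₗ ⟨Γ φₗ, Γ u⟩ Γ φᵢ`: for `S_R` through `C C* = β`, and for `B` by
    -- inserting `B = P B` and the mixed field of `B`.
    have hPBu : synthesisOp (translates φ) (analysisOp (translates F) (B u)) = B u := by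
      rw [← ContinuousLinearMap.comp_apply, h3, ← ContinuousLinearMap.comp_apply, hPB]
    filter_upwards [fiberization_synthesisOp_analysisOp hRb hRb u, hRz', hCspec,
      fiberization_synthesisOp_analysisOp hFb h1 (B u), hBfield.intertwines u]
      with x e1 e2 e3 e4 e5
    rw [frameOp_eq, ContinuousLinearMap.comp_apply, e1]
    rw [hPBu] at e4
    rw [e4, ← e5, mixedField_apply]
    simp only [e2, hz, Finset.smul_sum, sum_inner, inner_smul_left, inner_sum, inner_smul_right]
    rw [Finset.sum_comm]
    refine Finset.sum_congr rfl fun i _ => ?_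
    simp only [smul_smul]
    rw [← Finset.sum_smul]
    congr 1
    simp only [Finset.sum_mul]
    rw [Finset.sum_comm]
    refine Finset.sum_congr rfl fun l _ => ?_
    have e6 : ⟪fiberization (F i) x, fiberization (B (F l)) x⟫_ℂ =
        ∑ j, C x i j * starRingEnd ℂ (C x l j) := by
      have := congrFun (congrFun e3.1 i) l
      rw [mul_apply] at this
      exact this.symm
    rw [e6, Finset.mul_sum]
    refine Finset.sum_congr rfl fun j _ => ?_
    ring

/-- Once `B` is written as `S_R` with `T_R T_F^* = 0`, the family `E(φ + R)` is a dual, and its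
frame operator splits without cross terms. -/
theorem additiveModel_subset_image_frameOp (hV : IsFSI V) (hW : IsFSI W) (hVW : IsCompl V Wᗮ)
    (hF : IsFrameFor W (translates F)) :
    additiveModel V (canonicalObliqueDual V W hVW (translates F)) ⊆
      frameOp '' shiftGeneratedDuals V W F := by
  rintro _ ⟨B, hB, hBs, hBV, hrank, rfl⟩
  obtain ⟨R, hRV, hR, hRF, rfl⟩ := exists_frameOp_eq hV hW hVW hF hB hBs hBV hrank
  obtain ⟨h1, h2, h3⟩ := exists_dualGen hV hW hVW hF
  have hcd := canonicalObliqueDual_eq_translates hV hW hVW hF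
  have hG : translates (fun i => dualGen V W hVW F i + R i) =
      fun p => canonicalObliqueDual V W hVW (translates F) p + translates R p := by
    rw [hcd]
    exact funext fun p => shiftBy_add _ _ _
  have hGV : ∀ i, dualGen V W hVW F i + R i ∈ V := fun i => V.add_mem (h2 i) (hRV i)
  refine ⟨translates fun i => dualGen V W hVW F i + R i,
    ⟨(mem_obliqueDuals_iff hV.isClosed hVW hF _).mpr
      ⟨fun p => hV.shiftBy_mem _ (hGV _), ?_, ?_⟩, _, hGV, rfl⟩, ?_⟩
  · rw [hG, hcd]
    exact h1.add hR
  · rw [hG, hcd, synthesisOp_add h1 hR, ContinuousLinearMap.add_comp, h3, hRF, add_zero]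
  · rw [hG]
    exact frameOp_canonicalObliqueDual_add hV.isClosed hVW hF hR hRF

end Main

theorem mainTheorem9 {k n : ℕ} (V W : Submodule ℂ (L2R k)) (hV : IsFSI V) (hW : IsFSI W)
    (hVW : IsCompl V Wᗮ) (F : Fin n → L2R k) (hF : IsFrameFor W (translates F)) :
    canonicalObliqueDual V W hVW (translates F) =
        translates (fun i => canonicalObliqueDual V W hVW (translates F) (0, i)) ∧
      frameOp '' shiftGeneratedDuals V W F =
        additiveModel V (canonicalObliqueDual V W hVW (translates F)) := by
  have : CompleteSpace W := hW.isClosed.completeSpace_coe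
  exact ⟨canonicalObliqueDual_eq_translates hV hW hVW hF,
    (image_frameOp_subset hV hW hVW hF).antisymm
      (additiveModel_subset_image_frameOp hV hW hVW hF)⟩
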